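/- Let $n,m\ge 1$, $b\neq 0$, $D>0$ (a known delay), and consider $$\dot y_i=y_{i+1}+\psi_i(y_1,\dots,y_i)\ (1\le i\le n-1),\qquad \dot y_n=\psi_n(y_1,\dots,y_n)+b\,x_1(t-D),$$ $$\dot x_j=x_{j+1}+\varphi_j(x_1,\dots,x_j)\ (1\le j\le m-1),\qquad \dot x_m=\varphi_m(x_1,\dots,x_m)+U(t),$$ where $\psi_i\in C^{n+m-i}$, $\varphi_j\in C^{m-j}$, $\psi_i(0)=0$, $\varphi_j(0)=0$. Write $Y=(y_1,\dots,y_n)$, $X=(x_1,\dots,x_m)$ and $\dot Y=f(Y,b\,x_1(t-D))$ for the first subsystem. Let $s\in C^{n+m}([0,\infty))$ be the target trajectory. Given $Y(0)$, $X(0)$ and a history $x_1\in C^{m-1}([-D,0])$ (whose value at $0$ is the first entry of $X(0)$), suppose that the equation $$P(\theta)=Y(0)+\int_{-D}^{\theta}f(P(\sigma),b\,x_1(\sigma))\,d\sigma$$ has a continuous solution $P$ on $[-D,0]$. The predictor is continued to $t\ge 0$ by $P(t)=Y(t)+\int_{t-D}^{t}f(P(\sigma),b\,x_1(\sigma))\,d\sigma$.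 For gains $k_1,\dots,k_n$ put $h_0=0$ and, as functions of $(y_1,\dots,y_i)$ and $(s,\dots,s^{(i-1)})$, $$h_i=-k_i\bigl(y_i-h_{i-1}-s^{(i-1)}\bigr)-\psi_i+\sum_{l=1}^{i-1}\Bigl[\frac{\partial h_{i-1}}{\partial y_l}(y_{l+1}+\psi_l)+\frac{\partial h_{i-1}}{\partial s^{(l-1)}}s^{(l)}\Bigr],$$ and let $\Delta(t)=h_n\bigl(P(t),s(t+D),\dots,s^{(n-1)}(t+D)\bigr)+s^{(n)}(t+D)$. For gains $c_1,\dots,c_m$ put $\tau_0=0$ and, as functions of $(x_1,\dots,x_j)$ and $(\Delta,\dots,\Delta^{(j-1)})$, $$\tau_j=-c_j\bigl(b x_j-\tau_{j-1}-\Delta^{(j-1)}\bigr)-b\varphi_j+\sum_{l=1}^{j-1}\Bigl[\frac{\partial \tau_{j-1}}{\partial x_l}(x_{l+1}+\varphi_l)+\frac{\partial \tau_{j-1}}{\partial \Delta^{(l-1)}}\Delta^{(l)}\Bigr].$$ The nominal controller is $U(t)=\frac1b\bigl(\tau_m(X(t),\Delta(t),\dots,\Delta^{(m-1)}(t))+\Delta^{(m)}(t)\bigr)$,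 $t\ge0$, where the derivatives of $\Delta$ are taken along the solution on $[0,\infty)$ (one-sided at $0$). Assume: (a) $P_1(\theta)>s(\theta+D)$ for all $\theta\in[-D,0]$; (b) $b\,x_1(0)>\Delta(0)$; (c) $k_n>1$ and $k_i>\max\{2,\check k_i\}$ for $1\le i\le n-1$, where $$\check k_i=\frac{-P_{i+1}(0)-\psi_i+s^{(i)}(D)+\sum_{l=1}^{i-1}\bigl[\frac{\partial h_{i-1}}{\partial y_l}(P_{l+1}(0)+\psi_l)+\frac{\partial h_{i-1}}{\partial s^{(l-1)}}s^{(l)}(D)\bigr]}{P_i(0)-h_{i-1}-s^{(i-1)}(D)}$$ with all functions evaluated at $P(0)$, $s(D),s'(D),\dots$; (d) $c_m>1$ and $c_j>\max\{2,\check c_j\}$ for $1\le j\le m-1$, where $$\check c_j=\frac{-b x_{j+1}(0)-b\varphi_j+\Delta^{(j)}(0)+\sum_{l=1}^{j-1}\bigl[\frac{\partial \tau_{j-1}}{\partial x_l}(x_{l+1}(0)+\varphi_l)+\frac{\partial \tau_{j-1}}{\partial \Delta^{(l-1)}}\Delta^{(l)}(0)\bigr]}{b x_j(0)-\tau_{j-1}-\Delta^{(j-1)}(0)}$$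 with all functions evaluated at $X(0)$, $\Delta(0),\Delta'(0),\dots$. Then the closed-loop system has a solution on $[0,\infty)$, along every solution $\Delta$ is $m$ times continuously differentiable on $[0,\infty)$ (so that $U$ is well defined), and, with $$\Psi(t)=|X(t)|+|Y(t)|+\max_{x\in[0,1]}|P(t-D+Dx)|+\Bigl(\int_{t-D}^{t}x_1(\tau)^2\,d\tau\Bigr)^{1/2},$$ every solution has the following properties. Here $\sigma>0$ and $\gamma:\mathbb R\to\mathbb R$ depend only on the plant, the delay and the gains, not on $s$ or the initial data. 1. There is $C$ with $|y_1(t)-s(t)|\le Ce^{-\sigma t}$ for all $t\ge0$. If $s,s',\dots,s^{(n+m-1)}$ are bounded on $[0,\infty)$, then $\Psi$ is bounded on $[0,\infty)$. The ultimate bound depends only on the target trajectory: for every $s$ as above there is $T$ such that for all $t\ge \max\{T,0\}$ and all $M$, if $|s^{(i)}|\le M$ on $[t,t+D]$ for $0\le i\le n+m-1$, then $\Psi(t)\le\gamma(M)$. If $s\equiv0$, there is $C$ with $\Psi(t)\le Ce^{-\sigma t}$ for all $t\ge0$. 2. $y_1(t)\ge s(t)$ for all $t\ge0$. -/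

import Mathlib

/-- The first `i + 1` entries `(v 0, …, v i)` of a sequence. -/
def firstEntries (i : ℕ) (v : ℕ → ℝ) : Fin (i + 1) → ℝ := fun j => v j

/-- The coordinates of a vector of `ℝ^N` as a sequence, padded by zeros. -/
noncomputable def coords {N : ℕ} (v : EuclideanSpace ℝ (Fin N)) : ℕ → ℝ :=
  fun i => if h : i < N then v ⟨i, h⟩ else 0

/-- The partial derivative of `F` with respect to its `k`-th variable, at the point `v`. -/
noncomputable def partialDeriv (F : (ℕ → ℝ) → ℝ) (k : ℕ) (v : ℕ → ℝ) : ℝ :=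
  deriv (fun a => F (Function.update v k a)) (v k)

/-- The strict-feedback vector field on `ℝ^N` with scalar input `v` (all indices start at `0`):
the `i`-th component is `y_{i+1} + f_i(y_0, …, y_i)` for `i < N - 1`,
and the last one is `f_{N-1}(y_0, …, y_{N-1}) + v`. -/
noncomputable def strictFeedback (N : ℕ) (f : (i : ℕ) → (Fin (i + 1) → ℝ) → ℝ)
    (y : EuclideanSpace ℝ (Fin N)) (v : ℝ) : EuclideanSpace ℝ (Fin N) :=
  WithLp.toLp 2 fun i : Fin N =>
    (if (i : ℕ) + 1 < N then coords y (i + 1) else v) + f i (firstEntries i (coords y))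

/-- The sum
`∑_{k < i} [ ∂F/∂y_k (y_{k+1} + f_k(y_0, …, y_k)) + ∂F/∂σ_k σ_{k+1} ]`
for a function `F(y, σ)` of the state and of a reference signal with its derivatives. -/
noncomputable def chainSum (f : (i : ℕ) → (Fin (i + 1) → ℝ) → ℝ)
    (F : (ℕ → ℝ) → (ℕ → ℝ) → ℝ) (i : ℕ) (y σ : ℕ → ℝ) : ℝ :=
  ∑ k ∈ Finset.range i,
    (partialDeriv (fun y' => F y' σ) k y * (y (k + 1) + f k (firstEntries k y))
      + partialDeriv (fun σ' => F y σ') k σ * σ (k + 1))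

/-- The virtual controls of nonundershooting backstepping, for gains `κ`, input coefficient `β`
and nonlinearities `f`:
`α_0 = 0` and
`α_{i+1} = -κ_i (β y_i - α_i - σ_i) - β f_i(y_0, …, y_i)
  + ∑_{k < i} [ ∂α_i/∂y_k (y_{k+1} + f_k) + ∂α_i/∂σ_k σ_{k+1} ]`.
The functions `h_i` of the `Y`-part are `virtualControl 1 ψ k i`,
the functions `τ_j` of the `X`-part are `virtualControl b φ c j`. -/
noncomputable def virtualControl (β : ℝ) (f : (i : ℕ) → (Fin (i + 1) → ℝ) → ℝ) (κ : ℕ → ℝ) :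
    ℕ → (ℕ → ℝ) → (ℕ → ℝ) → ℝ
  | 0 => fun _ _ => 0
  | i + 1 => fun y σ =>
      -κ i * (β * y i - virtualControl β f κ i y σ - σ i) - β * f i (firstEntries i y)
        + chainSum f (virtualControl β f κ i) i y σ

/-- The lower bound (`ǩ_i`, resp. `č_j`) that the initial values impose on the `i`-th gain. -/
noncomputable def gainThreshold (β : ℝ) (f : (i : ℕ) → (Fin (i + 1) → ℝ) → ℝ) (κ : ℕ → ℝ)
    (i : ℕ) (y σ : ℕ → ℝ) : ℝ :=
  1 / (β * y i - virtualControl β f κ i y σ - σ i) *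
    (-β * y (i + 1) - β * f i (firstEntries i y) + σ (i + 1)
      + chainSum f (virtualControl β f κ i) i y σ)

/-- The condition on the `N` gains: each of the first `N - 1` exceeds `2` and its threshold,
and the last one exceeds `1`. -/
def GainCondition (N : ℕ) (β : ℝ) (f : (i : ℕ) → (Fin (i + 1) → ℝ) → ℝ) (κ : ℕ → ℝ)
    (y σ : ℕ → ℝ) : Prop :=
  (∀ i, i + 1 < N → max 2 (gainThreshold β f κ i y σ) < κ i) ∧ 1 < κ (N - 1)

/-- The sequence `(g(t), g'(t), g''(t), …)` of derivatives of a signal `g` on `[0, ∞)`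
(one-sided at `0`). -/
noncomputable def jet (g : ℝ → ℝ) (t : ℝ) : ℕ → ℝ :=
  fun i => iteratedDerivWithin i g (Set.Ici 0) t

/-- `Δ = h_n(p, s, …, s^(n-1)) + s^(n)` at time `t + D`, for the predicted state `p`. -/
noncomputable def deltaAt (n : ℕ) (ψ : (i : ℕ) → (Fin (i + 1) → ℝ) → ℝ) (k : ℕ → ℝ) (D : ℝ)
    (s : ℝ → ℝ) (p : EuclideanSpace ℝ (Fin n)) (t : ℝ) : ℝ :=
  virtualControl 1 ψ k n (coords p) (jet s (t + D)) + jet s (t + D) n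

/-- The signal `t ↦ Δ(t)` along a predictor trajectory `P`. -/
noncomputable def deltaSignal (n : ℕ) (ψ : (i : ℕ) → (Fin (i + 1) → ℝ) → ℝ) (k : ℕ → ℝ) (D : ℝ)
    (s : ℝ → ℝ) (P : ℝ → EuclideanSpace ℝ (Fin n)) : ℝ → ℝ :=
  fun t => deltaAt n ψ k D s (P t) t

/-- The nominal control law `b⁻¹ (τ_m(x, Δ, …, Δ^(m-1)) + Δ^(m))`, for the state `x` and the
sequence `δ = (Δ, Δ', Δ'', …)`. -/
noncomputable def nominalControl (m : ℕ) (b : ℝ) (φ : (i : ℕ) → (Fin (i + 1) → ℝ) → ℝ)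
    (c : ℕ → ℝ) (x : EuclideanSpace ℝ (Fin m)) (δ : ℕ → ℝ) : ℝ :=
  1 / b * (virtualControl b φ c m (coords x) δ + δ m)

/-- The signal `x_1` on `[-D, ∞)`: the history `ξ` up to time `0`, the first entry of `X` after. -/
noncomputable def inputSignal {m : ℕ} (ξ : ℝ → ℝ) (X : ℝ → EuclideanSpace ℝ (Fin m)) : ℝ → ℝ :=
  fun t => if t ≤ 0 then ξ t else coords (X t) 0

/-- `P₀` is the initial predictor on `[-D, 0]`: a continuous solution there of
`P₀(θ) = Y₀ + ∫_{-D}^θ f(P₀(σ), b ξ(σ)) dσ`. -/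
structure IsInitialPredictor (n : ℕ) (ψ : (i : ℕ) → (Fin (i + 1) → ℝ) → ℝ) (b D : ℝ)
    (Y₀ : EuclideanSpace ℝ (Fin n)) (ξ : ℝ → ℝ) (P₀ : ℝ → EuclideanSpace ℝ (Fin n)) : Prop where
  continuousOn : ContinuousOn P₀ (Set.Icc (-D) 0)
  integral_eq : ∀ θ ∈ Set.Icc (-D) 0,
    P₀ θ = Y₀ + ∫ σ in (-D)..θ, strictFeedback n ψ (P₀ σ) (b * ξ σ)

/-- `(Y, X, P)` is a solution on `[0, ∞)` of the plant in closed loop with the predictor and the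
nominal control law, with initial values `Y₀`, `X₀`, history `ξ` of `x_1` and initial
predictor `P₀`. -/
structure IsClosedLoopSolution (n m : ℕ) (ψ φ : (i : ℕ) → (Fin (i + 1) → ℝ) → ℝ) (b D : ℝ)
    (k c : ℕ → ℝ) (s : ℝ → ℝ)
    (Y₀ : EuclideanSpace ℝ (Fin n)) (X₀ : EuclideanSpace ℝ (Fin m)) (ξ : ℝ → ℝ)
    (P₀ : ℝ → EuclideanSpace ℝ (Fin n))
    (Y : ℝ → EuclideanSpace ℝ (Fin n)) (X : ℝ → EuclideanSpace ℝ (Fin m))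
    (P : ℝ → EuclideanSpace ℝ (Fin n)) : Prop where
  init_Y : Y 0 = Y₀
  init_X : X 0 = X₀
  ode_Y : ∀ t, 0 ≤ t → HasDerivWithinAt Y
    (strictFeedback n ψ (Y t) (b * inputSignal ξ X (t - D))) (Set.Ici 0) t
  ode_X : ∀ t, 0 ≤ t → HasDerivWithinAt X
    (strictFeedback m φ (X t)
      (nominalControl m b φ c (X t) (jet (deltaSignal n ψ k D s P) t))) (Set.Ici 0) t
  init_P : ∀ θ ∈ Set.Icc (-D) 0, P θ = P₀ θ
  continuousOn_P : ContinuousOn P (Set.Ici (-D))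
  predictor : ∀ t, 0 ≤ t →
    P t = Y t + ∫ σ in (t - D)..t, strictFeedback n ψ (P σ) (b * inputSignal ξ X σ)

/-- The state norm `Ψ(t) = |X(t)| + |Y(t)| + max_{x ∈ [0,1]} |P(t - D + D x)|
+ (∫_{t-D}^t x_1(τ)² dτ)^{1/2}`. -/
noncomputable def stateNorm {n m : ℕ} (D : ℝ) (ξ : ℝ → ℝ) (Y : ℝ → EuclideanSpace ℝ (Fin n))
    (X : ℝ → EuclideanSpace ℝ (Fin m)) (P : ℝ → EuclideanSpace ℝ (Fin n)) (t : ℝ) : ℝ :=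
  ‖X t‖ + ‖Y t‖ + sSup ((fun x : ℝ => ‖P (t - D + D * x)‖) '' Set.Icc 0 1)
    + Real.sqrt (∫ τ in (t - D)..t, inputSignal ξ X τ ^ 2)

/-! The predictor removes the delay. By uniqueness for the plant equation, propagated over
successive intervals of length `D`, `Y(t) = P(t - D)` and `P` solves `P' = f(P, b x_1)`
(`predictor_eq_integral`). So `(P, bX)` is a single strict-feedback system of order `n + m` with
input `bU`, which has to track `s(t + D)`.

The two-stage design, `h_i` for `Y` and then `τ_j` for `X` with reference `Δ`, is one backstepping
design for this cascade: the errors agree at stage `n` by the choice of `Δ`, and differentiating an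
identity of errors along the trajectory gives the identity at the next stage
(`backstepError_cascade_add`). Hence all errors form a linear chain `z_i' = z_{i+1} - κ_i z_i`, and
the nominal control law says precisely that `z_{n+m} = 0`.

The gain thresholds are equivalent to positivity of the next initial error, so together with (a) and
(b) all `z_i(0)` are positive. A chain solved from its end upwards then stays nonnegative, and gains
above `1` give decay like `e^{-t}` (`linearChain_nonneg_decay`). Since `z_0 = P_1(t) - s(t + D)`,
this is both tracking and safety; on the first delay interval safety is hypothesis (a).

The map from states to errors is triangular and vanishes at the origin for zero reference. Its
inverse therefore bounds states by errors and the reference jet, linearly on bounded sets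
(`exists_state_bound`), which yields all statements on `Ψ`. The same inverse gives existence: the
linear chain is solved explicitly and pulled back, so no finite escape can occur. -/

/-! ### Calculus of functions of finitely many entries of two sequences. -/

/-- `F(y, σ)` is a `C^r` function of the first `i` entries of `y` and of `σ`. -/
def SmoothOfFirst (i r : ℕ) (F : (ℕ → ℝ) → (ℕ → ℝ) → ℝ) : Prop :=
  ∃ G : (Fin i → ℝ) × (Fin i → ℝ) → ℝ, ContDiff ℝ r G ∧
    ∀ y σ, F y σ = G (fun j => y j, fun j => σ j)

namespace SmoothOfFirst

variable {i i' r r' : ℕ} {F F₁ F₂ : (ℕ → ℝ) → (ℕ → ℝ) → ℝ}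

theorem mono (h : SmoothOfFirst i r F) (hi : i ≤ i') (hr : r' ≤ r) :
    SmoothOfFirst i' r' F := by
  obtain ⟨G, hG, hF⟩ := h
  refine ⟨fun p => G (fun j => p.1 (Fin.castLE hi j), fun j => p.2 (Fin.castLE hi j)), ?_, ?_⟩
  · exact (hG.of_le (by exact_mod_cast hr)).comp (by fun_prop)
  · intro y σ
    simp [hF]

theorem congr_first (h : SmoothOfFirst i r F) {y y' σ σ' : ℕ → ℝ} (hy : ∀ j < i, y j = y' j)
    (hσ : ∀ j < i, σ j = σ' j) : F y σ = F y' σ' := by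
  obtain ⟨G, -, hF⟩ := h
  rw [hF, hF]
  congr 2 <;> funext j
  exacts [hy j j.2, hσ j j.2]

theorem add (h₁ : SmoothOfFirst i r F₁) (h₂ : SmoothOfFirst i r F₂) :
    SmoothOfFirst i r fun y σ => F₁ y σ + F₂ y σ := by
  obtain ⟨G₁, hG₁, hF₁⟩ := h₁
  obtain ⟨G₂, hG₂, hF₂⟩ := h₂
  exact ⟨fun p => G₁ p + G₂ p, hG₁.add hG₂, fun y σ => by simp only [hF₁, hF₂]⟩

theorem mul (h₁ : SmoothOfFirst i r F₁) (h₂ : SmoothOfFirst i r F₂) :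
    SmoothOfFirst i r fun y σ => F₁ y σ * F₂ y σ := by
  obtain ⟨G₁, hG₁, hF₁⟩ := h₁
  obtain ⟨G₂, hG₂, hF₂⟩ := h₂
  exact ⟨fun p => G₁ p * G₂ p, hG₁.mul hG₂, fun y σ => by simp only [hF₁, hF₂]⟩

theorem const (a : ℝ) : SmoothOfFirst i r fun _ _ => a :=
  ⟨fun _ => a, contDiff_const, fun _ _ => rfl⟩

theorem sub (h₁ : SmoothOfFirst i r F₁) (h₂ : SmoothOfFirst i r F₂) :
    SmoothOfFirst i r fun y σ => F₁ y σ - F₂ y σ := by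
  obtain ⟨G₁, hG₁, hF₁⟩ := h₁
  obtain ⟨G₂, hG₂, hF₂⟩ := h₂
  exact ⟨fun p => G₁ p - G₂ p, hG₁.sub hG₂, fun y σ => by simp only [hF₁, hF₂]⟩

theorem fst {j : ℕ} (hj : j < i) : SmoothOfFirst i r fun y _ => y j :=
  ⟨fun p => p.1 ⟨j, hj⟩, by fun_prop, fun _ _ => rfl⟩

theorem snd {j : ℕ} (hj : j < i) : SmoothOfFirst i r fun _ σ => σ j :=
  ⟨fun p => p.2 ⟨j, hj⟩, by fun_prop, fun _ _ => rfl⟩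

theorem comp_firstEntries {j : ℕ} (hj : j < i) {g : (Fin (j + 1) → ℝ) → ℝ}
    (hg : ContDiff ℝ r g) : SmoothOfFirst i r fun y _ => g (firstEntries j y) := by
  refine ⟨fun p => g fun l => p.1 (Fin.castLE hj l), hg.comp (by fun_prop), fun y σ => ?_⟩
  rfl

theorem sum {ι : Type*} (s : Finset ι) {F : ι → (ℕ → ℝ) → (ℕ → ℝ) → ℝ}
    (h : ∀ a ∈ s, SmoothOfFirst i r (F a)) :
    SmoothOfFirst i r fun y σ => ∑ a ∈ s, F a y σ := by
  classical
  induction s using Finset.induction_on with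
  | empty => simpa using const 0
  | insert a s ha ih =>
    simp only [Finset.sum_insert ha]
    exact (h a (by simp)).add (ih fun a' ha' => h a' (by simp [ha']))

/-- Updating one entry of the sequence moves the finite vector along a coordinate direction, so the
partial derivative is a value of the Fréchet derivative; smoothness of partial derivatives follows
from this. -/
theorem partialDeriv_fst_eq {G : (Fin i → ℝ) × (Fin i → ℝ) → ℝ} (hG : Differentiable ℝ G)
    (hF : ∀ y σ, F y σ = G (fun j => y j, fun j => σ j)) {k : ℕ} (hk : k < i) (y σ : ℕ → ℝ) :
    partialDeriv (fun y' => F y' σ) k y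
      = fderiv ℝ G (fun j => y j, fun j => σ j) (Pi.single ⟨k, hk⟩ 1, 0) := by
  have h1 : ∀ a, (fun j : Fin i => Function.update y k a j)
      = Function.update (fun j : Fin i => y j) ⟨k, hk⟩ a := by
    intro a
    funext j
    by_cases hj : j = ⟨k, hk⟩
    · subst hj; simp
    · have : (j : ℕ) ≠ k := fun h => hj (Fin.ext h)
      simp [hj, this]
  have h2 : HasDerivAt (fun a => ((Function.update (fun j : Fin i => y j) ⟨k, hk⟩ a,
      fun j : Fin i => σ j) : (Fin i → ℝ) × (Fin i → ℝ))) (Pi.single ⟨k, hk⟩ 1, 0) (y k) :=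
    (hasDerivAt_update _ _ _).prodMk (hasDerivAt_const _ _)
  unfold partialDeriv
  simp only [hF, h1]
  refine HasDerivAt.deriv ?_
  have h3 := (hG ((Function.update (fun j : Fin i => y j) ⟨k, hk⟩ (y k),
      fun j : Fin i => σ j))).hasFDerivAt.comp_hasDerivAt (y k) h2
  rw [show Function.update (fun j : Fin i => y j) ⟨k, hk⟩ (y k) = fun j : Fin i => y j from
    Function.update_eq_self (f := fun j : Fin i => y j) ⟨k, hk⟩] at h3
  exact h3

theorem partialDeriv_snd_eq {G : (Fin i → ℝ) × (Fin i → ℝ) → ℝ} (hG : Differentiable ℝ G)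
    (hF : ∀ y σ, F y σ = G (fun j => y j, fun j => σ j)) {k : ℕ} (hk : k < i) (y σ : ℕ → ℝ) :
    partialDeriv (fun σ' => F y σ') k σ
      = fderiv ℝ G (fun j => y j, fun j => σ j) (0, Pi.single ⟨k, hk⟩ 1) := by
  have h := partialDeriv_fst_eq (F := fun y σ => F σ y) (G := fun p => G p.swap)
    (hG.comp (differentiable_snd.prodMk differentiable_fst)) (fun y σ => by simp [hF]) hk σ y
  rw [h]
  have h3 : HasFDerivAt (fun p => G p.swap) ((fderiv ℝ G (fun j => y j, fun j => σ j)).comp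
      (ContinuousLinearEquiv.prodComm ℝ (Fin i → ℝ) (Fin i → ℝ)).toContinuousLinearMap)
      (fun j => σ j, fun j => y j) :=
    (hG _).hasFDerivAt.comp (fun j : Fin i => σ j, fun j : Fin i => y j)
      (ContinuousLinearEquiv.prodComm ℝ (Fin i → ℝ) (Fin i → ℝ)).hasFDerivAt
  rw [h3.fderiv]
  simp

theorem partialDeriv_fst (h : SmoothOfFirst i (r + 1) F) {k : ℕ} (hk : k < i) :
    SmoothOfFirst i r fun y σ => partialDeriv (fun y' => F y' σ) k y := by
  obtain ⟨G, hG, hF⟩ := h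
  refine ⟨fun p => fderiv ℝ G p (Pi.single ⟨k, hk⟩ 1, 0), ?_, fun y σ => ?_⟩
  · exact (hG.fderiv_right (m := r) (by push_cast; rfl)).clm_apply contDiff_const
  · exact partialDeriv_fst_eq (hG.differentiable (by simp)) hF hk y σ

theorem partialDeriv_snd (h : SmoothOfFirst i (r + 1) F) {k : ℕ} (hk : k < i) :
    SmoothOfFirst i r fun y σ => partialDeriv (fun σ' => F y σ') k σ := by
  obtain ⟨G, hG, hF⟩ := h
  refine ⟨fun p => fderiv ℝ G p (0, Pi.single ⟨k, hk⟩ 1), ?_, fun y σ => ?_⟩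
  · exact (hG.fderiv_right (m := r) (by push_cast; rfl)).clm_apply contDiff_const
  · exact partialDeriv_snd_eq (hG.differentiable (by simp)) hF hk y σ

/-- The chain rule along a trajectory. -/
theorem hasDerivWithinAt (h : SmoothOfFirst i 1 F) {s : Set ℝ} {t : ℝ} {y σ : ℕ → ℝ → ℝ}
    {y' σ' : ℕ → ℝ} (hy : ∀ k < i, HasDerivWithinAt (y k) (y' k) s t)
    (hσ : ∀ k < i, HasDerivWithinAt (σ k) (σ' k) s t) :
    HasDerivWithinAt (fun τ => F (fun k => y k τ) (fun k => σ k τ))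
      (∑ k ∈ Finset.range i,
        (partialDeriv (fun y' => F y' fun k => σ k t) k (fun k => y k t) * y' k
          + partialDeriv (fun σ' => F (fun k => y k t) σ') k (fun k => σ k t) * σ' k)) s t := by
  obtain ⟨G, hG, hF⟩ := h
  have hd : Differentiable ℝ G := hG.differentiable (by simp)
  have h1 : HasDerivWithinAt (fun τ => ((fun j : Fin i => y j τ, fun j : Fin i => σ j τ) :
      (Fin i → ℝ) × (Fin i → ℝ))) (fun j : Fin i => y' j, fun j : Fin i => σ' j) s t :=
    (hasDerivWithinAt_pi.2 fun j : Fin i => hy j j.2).prodMk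
      (hasDerivWithinAt_pi.2 fun j : Fin i => hσ j j.2)
  have h2 := (hd (fun j : Fin i => y j t, fun j : Fin i => σ j t)).hasFDerivAt.comp_hasDerivWithinAt
    t h1
  rw [show (fun τ => F (fun k => y k τ) fun k => σ k τ) = _ from funext fun τ => hF _ _]
  refine h2.congr_deriv ?_
  symm
  rw [Finset.sum_range fun k =>
        (partialDeriv (fun y' => F y' fun k => σ k t) k (fun k => y k t) * y' k
          + partialDeriv (fun σ' => F (fun k => y k t) σ') k (fun k => σ k t) * σ' k)]
  -- Splitting the velocity along the coordinate directions turns the Fréchet derivative into the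
  -- sum of partial derivatives.
  have h3 : ((fun j : Fin i => y' j, fun j : Fin i => σ' j) : (Fin i → ℝ) × (Fin i → ℝ))
      = ∑ j : Fin i, (y' j • ((Pi.single j 1, 0) : (Fin i → ℝ) × (Fin i → ℝ))
        + σ' j • ((0, Pi.single j 1) : (Fin i → ℝ) × (Fin i → ℝ))) := by
    ext l <;> simp [Prod.fst_sum, Prod.snd_sum, Finset.sum_apply, Pi.single_apply]
  rw [h3, map_sum]
  refine Finset.sum_congr rfl fun j _ => ?_
  rw [partialDeriv_fst_eq hd hF j.2, partialDeriv_snd_eq hd hF j.2, map_add, map_smul, map_smul]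
  simp [mul_comm]

theorem contDiffOn (h : SmoothOfFirst i r F) {s : Set ℝ} {y σ : ℕ → ℝ → ℝ}
    (hy : ∀ k < i, ContDiffOn ℝ r (y k) s) (hσ : ∀ k < i, ContDiffOn ℝ r (σ k) s) :
    ContDiffOn ℝ r (fun τ => F (fun k => y k τ) (fun k => σ k τ)) s := by
  obtain ⟨G, hG, hF⟩ := h
  simp only [hF]
  exact hG.comp_contDiffOn
    ((contDiffOn_pi.2 fun j : Fin i => hy j j.2).prodMk
      (contDiffOn_pi.2 fun j : Fin i => hσ j j.2))

/-- A `C¹` function that vanishes at the origin has linear growth on bounded sets. -/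
theorem exists_bound (h : SmoothOfFirst i 1 F) (h0 : F 0 0 = 0) (R : ℝ) :
    ∃ L, 0 ≤ L ∧ ∀ y σ : ℕ → ℝ, ∀ ε : ℝ, ε ≤ R → 0 ≤ ε → (∀ j < i, |y j| ≤ ε) →
      (∀ j < i, |σ j| ≤ ε) → |F y σ| ≤ L * ε := by
  obtain ⟨G, hG, hF⟩ := h
  have hd : Differentiable ℝ G := hG.differentiable (by simp)
  obtain ⟨L, hL⟩ := (isCompact_closedBall (0 : (Fin i → ℝ) × (Fin i → ℝ)) R).exists_bound_of_continuousOn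
    (hG.continuous_fderiv (by simp)).continuousOn
  -- For `R < 0` the ball is empty and the bound `L` may be negative.
  refine ⟨max L 0, le_max_right _ _, fun y σ ε hεR hε hy hσ => ?_⟩
  have hp : ‖((fun j : Fin i => y j, fun j : Fin i => σ j) : (Fin i → ℝ) × (Fin i → ℝ))‖ ≤ ε := by
    refine (norm_prod_le_iff).2 ⟨?_, ?_⟩
    · exact (pi_norm_le_iff_of_nonneg hε).2 fun j => hy j j.2
    · exact (pi_norm_le_iff_of_nonneg hε).2 fun j => hσ j j.2
  have h0' : G 0 = 0 := by rw [← h0, hF]; rfl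
  have := (convex_closedBall (0 : (Fin i → ℝ) × (Fin i → ℝ)) R).norm_image_sub_le_of_norm_fderiv_le
    (fun x _ => hd x) (fun x hx => (hL x hx).trans (le_max_left L 0))
    (x := 0) (by simpa using hε.trans hεR) (y := (fun j : Fin i => y j, fun j : Fin i => σ j))
    (by simpa using hp.trans hεR)
  rw [h0', sub_zero, sub_zero] at this
  rw [hF]
  exact this.trans (by gcongr)

end SmoothOfFirst

/-! ### Regularity and locality of the virtual controls. -/

theorem SmoothOfFirst.chainSum {f : (i : ℕ) → (Fin (i + 1) → ℝ) → ℝ}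
    {F : (ℕ → ℝ) → (ℕ → ℝ) → ℝ} {i r : ℕ} (hf : ∀ k < i, ContDiff ℝ r (f k))
    (h : SmoothOfFirst i (r + 1) F) : SmoothOfFirst (i + 1) r (chainSum f F i) := by
  unfold _root_.chainSum
  refine sum _ fun k hk => ?_
  have hk : k < i := Finset.mem_range.1 hk
  exact (((h.partialDeriv_fst hk).mono i.le_succ le_rfl).mul
    ((fst (by omega)).add (comp_firstEntries (by omega) (hf k hk)))).add
    (((h.partialDeriv_snd hk).mono i.le_succ le_rfl).mul (snd (by omega)))

/-- Each stage differentiates the previous control once, so the `i`-th control is `C^{N-i}`. The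
assumed smoothness of `f_i` matches this loss exactly. -/
theorem smoothOfFirst_virtualControl {β : ℝ} {f : (i : ℕ) → (Fin (i + 1) → ℝ) → ℝ} {κ : ℕ → ℝ}
    {N : ℕ} (hf : ∀ i < N, ContDiff ℝ ((N - (i + 1) : ℕ) : WithTop ℕ∞) (f i)) (i : ℕ) :
    ∀ r, i + r ≤ N → SmoothOfFirst i r (virtualControl β f κ i) := by
  induction i with
  | zero => exact fun r _ => SmoothOfFirst.const 0
  | succ i ih =>
    intro r hr
    have hf' : ∀ k ≤ i, ContDiff ℝ r (f k) := fun k hk =>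
      (hf k (by omega)).of_le (by exact_mod_cast (by omega : r ≤ N - (k + 1)))
    have h := ih (r + 1) (by omega)
    simp only [virtualControl]
    exact ((((SmoothOfFirst.const (-κ i)).mul (((SmoothOfFirst.const β).mul
      (SmoothOfFirst.fst i.lt_succ_self)).sub (h.mono i.le_succ r.le_succ) |>.sub
        (SmoothOfFirst.snd i.lt_succ_self))).sub ((SmoothOfFirst.const β).mul
          (SmoothOfFirst.comp_firstEntries i.lt_succ_self (hf' i le_rfl))))).add
      (h.chainSum fun k hk => hf' k hk.le)

theorem virtualControl_zero {β : ℝ} {f : (i : ℕ) → (Fin (i + 1) → ℝ) → ℝ} {κ : ℕ → ℝ}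
    (i : ℕ) (hf : ∀ j < i, f j 0 = 0) : virtualControl β f κ i 0 0 = 0 := by
  induction i with
  | zero => rfl
  | succ i ih =>
    have h0 : ∀ j, firstEntries j (0 : ℕ → ℝ) = 0 := fun j => rfl
    simp only [virtualControl, chainSum, h0, ih fun j hj => hf j (by omega), hf i (by omega)]
    rw [Finset.sum_eq_zero fun k hk => ?_]
    · simp
    · rw [hf k (by have := Finset.mem_range.1 hk; omega)]; simp

theorem virtualControl_congr {β : ℝ} {f f' : (i : ℕ) → (Fin (i + 1) → ℝ) → ℝ} {κ κ' : ℕ → ℝ}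
    (i : ℕ) (hf : ∀ j < i, f j = f' j) (hκ : ∀ j < i, κ j = κ' j) :
    virtualControl β f κ i = virtualControl β f' κ' i := by
  induction i with
  | zero => rfl
  | succ i ih =>
    have ih := ih (fun j hj => hf j (by omega)) (fun j hj => hκ j (by omega))
    funext y σ
    simp only [virtualControl, ih, hf i i.lt_succ_self, hκ i i.lt_succ_self, chainSum]
    congr 1
    refine Finset.sum_congr rfl fun k hk => ?_
    rw [hf k (by have := Finset.mem_range.1 hk; omega)]

/-! ### Backstepping errors along trajectories, and the inverse change of variables. -/

/-- The backstepping error `β y_i - α_i - σ_i`. -/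
noncomputable def backstepError (β : ℝ) (f : (i : ℕ) → (Fin (i + 1) → ℝ) → ℝ) (κ : ℕ → ℝ)
    (i : ℕ) (y σ : ℕ → ℝ) : ℝ :=
  β * y i - virtualControl β f κ i y σ - σ i

theorem backstepError_succ (β : ℝ) (f : (i : ℕ) → (Fin (i + 1) → ℝ) → ℝ) (κ : ℕ → ℝ)
    (i : ℕ) (y σ : ℕ → ℝ) :
    backstepError β f κ (i + 1) y σ = β * y (i + 1) + κ i * backstepError β f κ i y σ
      + β * f i (firstEntries i y) - chainSum f (virtualControl β f κ i) i y σ - σ (i + 1) := by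
  simp only [backstepError, virtualControl]
  ring

section Trajectory

variable {β : ℝ} {f : (i : ℕ) → (Fin (i + 1) → ℝ) → ℝ} {κ : ℕ → ℝ} {N : ℕ}
  {y σ : ℕ → ℝ → ℝ} {s : Set ℝ} {t : ℝ}

theorem hasDerivWithinAt_virtualControl
    (hf : ∀ i < N, ContDiff ℝ ((N - (i + 1) : ℕ) : WithTop ℕ∞) (f i)) {i : ℕ} (hi : i < N)
    (hσ : ∀ j < i, HasDerivWithinAt (σ j) (σ (j + 1) t) s t)
    (hy : ∀ j < i, HasDerivWithinAt (y j)
      (y (j + 1) t + f j (firstEntries j fun l => y l t)) s t) :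
    HasDerivWithinAt (fun τ => virtualControl β f κ i (fun l => y l τ) fun l => σ l τ)
      (chainSum f (virtualControl β f κ i) i (fun l => y l t) fun l => σ l t) s t :=
  (smoothOfFirst_virtualControl hf i 1 (by omega)).hasDerivWithinAt hy hσ

/-- Along a trajectory of the strict-feedback system the backstepping errors form a linear
chain of integrators. -/
theorem hasDerivWithinAt_backstepError
    (hf : ∀ i < N, ContDiff ℝ ((N - (i + 1) : ℕ) : WithTop ℕ∞) (f i))
    (hσ : ∀ j < N, HasDerivWithinAt (σ j) (σ (j + 1) t) s t)
    (hy : ∀ j < N, HasDerivWithinAt (y j)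
      (y (j + 1) t + f j (firstEntries j fun l => y l t)) s t) {i : ℕ} (hi : i < N) :
    HasDerivWithinAt (fun τ => backstepError β f κ i (fun l => y l τ) fun l => σ l τ)
      (backstepError β f κ (i + 1) (fun l => y l t) (fun l => σ l t)
        - κ i * backstepError β f κ i (fun l => y l t) (fun l => σ l t)) s t := by
  have h := ((((hy i hi).const_mul β)).sub (hasDerivWithinAt_virtualControl (β := β) (κ := κ) hf hi
    (fun j hj => hσ j (hj.trans hi)) (fun j hj => hy j (hj.trans hi)))).sub (hσ i hi)
  refine h.congr_deriv ?_
  rw [backstepError_succ]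
  ring

/-- Conversely, a chain of integrators yields a trajectory of the strict-feedback system. -/
theorem hasDerivWithinAt_of_backstepError
    (hf : ∀ i < N, ContDiff ℝ ((N - (i + 1) : ℕ) : WithTop ℕ∞) (f i)) {z : ℕ → ℝ → ℝ}
    (hz : ∀ j < N, HasDerivWithinAt (z j) (z (j + 1) t - κ j * z j t) s t)
    (hσ : ∀ j < N, HasDerivWithinAt (σ j) (σ (j + 1) t) s t)
    (hyz : ∀ i ≤ N, ∀ τ, y i τ = z i τ + virtualControl 1 f κ i (fun l => y l τ) (fun l => σ l τ)
      + σ i τ) (i : ℕ) :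
    i < N → HasDerivWithinAt (y i) (y (i + 1) t + f i (firstEntries i fun l => y l t)) s t := by
  induction i using Nat.strong_induction_on with
  | _ i ih =>
    intro hi
    have h := ((hz i hi).add (hasDerivWithinAt_virtualControl (β := 1) (κ := κ) hf hi
      (fun j hj => hσ j (hj.trans hi)) (fun j hj => ih j hj (hj.trans hi)))).add (hσ i hi)
    -- For `i + 1 = N` this is the relation that defines the input slot `y N`.
    have h1 := hyz (i + 1) hi t
    have h2 := hyz i hi.le t
    simp only [virtualControl] at h1
    rw [show y i = _ from funext (hyz i hi.le)]
    refine h.congr_deriv ?_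
    rw [h1]
    linear_combination κ i * h2

end Trajectory

/-- The change of variables from states to backstepping errors is onto. -/
theorem exists_state_of_backstepError {f : (i : ℕ) → (Fin (i + 1) → ℝ) → ℝ} {κ : ℕ → ℝ} {N : ℕ}
    (hf : ∀ i < N, ContDiff ℝ ((N - (i + 1) : ℕ) : WithTop ℕ∞) (f i)) (z σ : ℕ → ℝ) (n : ℕ)
    (hn : n ≤ N + 1) :
    ∃ y : ℕ → ℝ, ∀ i < n, y i = z i + virtualControl 1 f κ i y σ + σ i := by
  induction n with
  | zero => exact ⟨0, by simp⟩
  | succ n ih =>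
    obtain ⟨y, hy⟩ := ih (by omega)
    -- The `i`-th control reads only entries below `i`, so setting entry `n` leaves the relations
    -- already obtained intact.
    refine ⟨Function.update y n (z n + virtualControl 1 f κ n y σ + σ n), fun i hi => ?_⟩
    have hc : virtualControl 1 f κ i
        (Function.update y n (z n + virtualControl 1 f κ n y σ + σ n)) σ
        = virtualControl 1 f κ i y σ :=
      (smoothOfFirst_virtualControl hf i 0 (by omega)).congr_first
        (fun j hj => by simp [show j ≠ n by omega]) (fun _ _ => rfl)
    rw [hc]
    rcases Nat.lt_succ_iff_lt_or_eq.1 hi with h | rfl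
    · simpa [h.ne] using hy i h
    · simp

/-! ### Derivatives of signals on the half-line. -/

theorem contDiffOn_succ_of_hasDerivWithinAt {r : ℕ} {f f' : ℝ → ℝ} {s : Set ℝ}
    (hs : UniqueDiffOn ℝ s) (hf : ∀ t ∈ s, HasDerivWithinAt f (f' t) s t)
    (h : ContDiffOn ℝ r f' s) : ContDiffOn ℝ ((r + 1 : ℕ) : WithTop ℕ∞) f s := by
  push_cast
  rw [contDiffOn_succ_iff_derivWithin hs]
  refine ⟨fun t ht => (hf t ht).differentiableWithinAt, by simp, ?_⟩
  exact h.congr fun t ht => (hf t ht).derivWithin (hs t ht)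

theorem hasDerivWithinAt_jet {N : ℕ} {g : ℝ → ℝ} (hg : ContDiffOn ℝ N g (Set.Ici 0)) {i : ℕ}
    (hi : i < N) {t : ℝ} (ht : 0 ≤ t) :
    HasDerivWithinAt (fun τ => jet g τ i) (jet g t (i + 1)) (Set.Ici 0) t := by
  have h := hg.differentiableOn_iteratedDerivWithin (m := i) (by exact_mod_cast hi)
    (uniqueDiffOn_Ici 0) t ht
  have h2 := h.hasDerivWithinAt
  rwa [← iteratedDerivWithin_succ] at h2

theorem contDiffOn_jet {N : ℕ} {g : ℝ → ℝ} (hg : ContDiffOn ℝ N g (Set.Ici 0)) {r : ℕ} :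
    ∀ {i : ℕ}, i + r ≤ N → ContDiffOn ℝ r (fun t => jet g t i) (Set.Ici 0) := by
  induction r with
  | zero =>
    intro i hi
    exact contDiffOn_zero.2 (hg.continuousOn_iteratedDerivWithin (by exact_mod_cast hi)
      (uniqueDiffOn_Ici 0))
  | succ r ih =>
    intro i hi
    exact contDiffOn_succ_of_hasDerivWithinAt (uniqueDiffOn_Ici 0)
      (fun t ht => hasDerivWithinAt_jet hg (by omega) ht) (ih (by omega))

/-! ### Linear chains: positivity, decay and existence. -/

/-- The integrating factor `e^{κt}` makes `q e^{κt}` nondecreasing. -/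
theorem nonneg_of_neg_mul_le_deriv {q q' : ℝ → ℝ} {κ : ℝ}
    (hq : ∀ t, 0 ≤ t → HasDerivWithinAt q (q' t) (Set.Ici 0) t)
    (hq' : ∀ t, 0 ≤ t → -κ * q t ≤ q' t) (h0 : 0 ≤ q 0) {t : ℝ} (ht : 0 ≤ t) : 0 ≤ q t := by
  have hd : ∀ t, 0 ≤ t → HasDerivWithinAt (fun τ => q τ * Real.exp (κ * τ))
      (q' t * Real.exp (κ * t) + q t * (Real.exp (κ * t) * (κ * 1))) (Set.Ici 0) t := fun t ht =>
    (hq t ht).mul (((hasDerivAt_id t).const_mul κ).exp.hasDerivWithinAt)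
  have hmono : MonotoneOn (fun τ => q τ * Real.exp (κ * τ)) (Set.Ici 0) := by
    refine monotoneOn_of_hasDerivWithinAt_nonneg (convex_Ici 0)
      (fun t ht => (hd t ht).continuousWithinAt)
      (fun t ht => (hd t (interior_subset ht)).mono interior_subset) fun t ht => ?_
    have := hq' t (interior_subset ht)
    have hp := Real.exp_pos (κ * t)
    nlinarith
  have h := hmono (Set.mem_Ici.2 le_rfl) ht ht
  simp only [mul_zero, Real.exp_zero, mul_one] at h
  exact nonneg_of_mul_nonneg_left (h0.trans h) (Real.exp_pos _)

/-- A chain `z_i' = z_{i+1} - κ_i z_i` of first-order systems with gains above `1` and nonnegative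
initial values stays nonnegative and decays exponentially. -/
theorem linearChain_nonneg_decay {N : ℕ} {κ : ℕ → ℝ} {z : ℕ → ℝ → ℝ} (hκ : ∀ i < N, 1 < κ i)
    (hz : ∀ i < N, ∀ t, 0 ≤ t → HasDerivWithinAt (z i) (z (i + 1) t - κ i * z i t) (Set.Ici 0) t)
    (hN : ∀ t, 0 ≤ t → z N t = 0) (h0 : ∀ i < N, 0 ≤ z i 0) (j : ℕ) :
    ∀ i, i + j = N → ∃ C, 0 ≤ C ∧ ∀ t, 0 ≤ t → 0 ≤ z i t ∧ z i t ≤ C * Real.exp (-t) := by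
  induction j with
  | zero =>
    rintro i rfl
    exact ⟨0, le_rfl, fun t ht => by simp [show z i t = 0 from hN t ht]⟩
  | succ j ih =>
    intro i hi
    obtain ⟨C, hC, hb⟩ := ih (i + 1) (by omega)
    have hiN : i < N := by omega
    have hk := hκ i hiN
    -- `A` dominates the initial value, and `C ≤ (κ_i - 1) A` makes `A e^{-t}` a supersolution of
    -- the equation for `z_i`.
    have hA1 : z i 0 ≤ max (z i 0) (C / (κ i - 1)) := le_max_left _ _
    have hA2 : C ≤ (κ i - 1) * max (z i 0) (C / (κ i - 1)) := by
      have := le_max_right (z i 0) (C / (κ i - 1))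
      rwa [div_le_iff₀' (by linarith)] at this
    generalize max (z i 0) (C / (κ i - 1)) = A at hA1 hA2
    refine ⟨A, (h0 i hiN).trans hA1, fun t ht => ⟨?_, ?_⟩⟩
    · exact nonneg_of_neg_mul_le_deriv (κ := κ i) (hz i hiN)
        (fun t ht => by linarith [(hb t ht).1]) (h0 i hiN) ht
    · have hd : ∀ t, 0 ≤ t → HasDerivWithinAt (fun τ => A * Real.exp (-τ) - z i τ)
          (A * (Real.exp (-t) * -1) - (z (i + 1) t - κ i * z i t)) (Set.Ici 0) t := fun t ht =>
        (((hasDerivAt_neg t).exp.const_mul A).hasDerivWithinAt).sub (hz i hiN t ht)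
      have := nonneg_of_neg_mul_le_deriv (κ := κ i) hd (fun t ht => by
        nlinarith [(hb t ht).2, Real.exp_pos (-t)]) (by simpa using hA1) ht
      linarith

/-- Induction at the head of the chain: the tail is solved with shifted gains and drives the first
equation, which is solved by variation of constants. -/
theorem exists_linearChain (N : ℕ) : ∀ κ a : ℕ → ℝ, ∃ z : ℕ → ℝ → ℝ, (∀ i < N, z i 0 = a i) ∧
    (∀ i, Continuous (z i)) ∧
    (∀ i < N, ∀ t, HasDerivAt (z i) (z (i + 1) t - κ i * z i t) t) ∧ ∀ t, z N t = 0 := by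
  induction N with
  | zero => exact fun κ a => ⟨fun _ _ => 0, by simp, fun _ => continuous_const, by simp, by simp⟩
  | succ N ih =>
    intro κ a
    obtain ⟨z, h0, hc, hz, hN⟩ := ih (fun i => κ (i + 1)) (fun i => a (i + 1))
    have hint : Continuous fun τ => Real.exp (κ 0 * τ) * z 0 τ := by
      have := hc 0
      fun_prop
    have hd : ∀ t, HasDerivAt
        (fun t => Real.exp (-κ 0 * t) * (a 0 + ∫ τ in (0 : ℝ)..t, Real.exp (κ 0 * τ) * z 0 τ))
        (z 0 t - κ 0 * (Real.exp (-κ 0 * t) *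
          (a 0 + ∫ τ in (0 : ℝ)..t, Real.exp (κ 0 * τ) * z 0 τ))) t := by
      intro t
      have h1 := (((hasDerivAt_id t).const_mul (-κ 0)).exp).mul
        ((hint.integral_hasStrictDerivAt 0 t).hasDerivAt.const_add (a 0))
      refine h1.congr_deriv ?_
      have : Real.exp (-κ 0 * t) * (Real.exp (κ 0 * t) * z 0 t) = z 0 t := by
        rw [← mul_assoc, ← Real.exp_add]; simp
      simp only [id, this]
      ring
    refine ⟨fun i => Nat.casesOn i
      (fun t => Real.exp (-κ 0 * t) * (a 0 + ∫ τ in (0 : ℝ)..t, Real.exp (κ 0 * τ) * z 0 τ)) z,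
      ?_, ?_, ?_, hN⟩
    · rintro (_ | i) hi
      · simp
      · exact h0 i (by omega)
    · rintro (_ | i)
      · exact continuous_iff_continuousAt.2 fun t => (hd t).continuousAt
      · exact hc i
    · rintro (_ | i) hi
      · exact hd
      · exact hz i (by omega)

/-! ### State bounds and the gain conditions. -/

/-- The states are bounded by the backstepping errors and the reference jet, linearly on
bounded sets. -/
theorem exists_state_bound {f : (i : ℕ) → (Fin (i + 1) → ℝ) → ℝ} {κ : ℕ → ℝ} {N : ℕ}
    (hf : ∀ i < N, ContDiff ℝ ((N - (i + 1) : ℕ) : WithTop ℕ∞) (f i)) (hf0 : ∀ i < N, f i 0 = 0)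
    (R : ℝ) (n : ℕ) (hn : n ≤ N) :
    ∃ L, 0 ≤ L ∧ ∀ y σ : ℕ → ℝ, ∀ ε : ℝ, ε ≤ R → 0 ≤ ε →
      (∀ i < n, |backstepError 1 f κ i y σ| ≤ ε) → (∀ i < n, |σ i| ≤ ε) →
        ∀ i < n, |y i| ≤ L * ε := by
  induction n with
  | zero => exact ⟨0, le_rfl, by simp⟩
  | succ n ih =>
    obtain ⟨L, hL, h⟩ := ih (by omega)
    obtain ⟨K, hK, hb⟩ := (smoothOfFirst_virtualControl (β := 1) (κ := κ) hf n 1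
      (by omega)).exists_bound (virtualControl_zero n fun j hj => hf0 j (by omega))
        (max L 1 * R)
    -- The new entry is error plus virtual control plus reference: the first and last contribute
    -- `2`. The control has arguments of size at most `max L 1 * ε`, which explains the radius `max
    -- L 1 * R` above.
    refine ⟨max L (2 + K * max L 1), hL.trans (le_max_left _ _), fun y σ ε hεR hε he hσ i hi => ?_⟩
    have hy := h y σ ε hεR hε (fun i hi => he i (by omega)) (fun i hi => hσ i (by omega))
    rcases Nat.lt_succ_iff_lt_or_eq.1 hi with hi | rfl
    · exact (hy i hi).trans (by gcongr; exact le_max_left _ _)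
    · have h1 := hb y σ (max L 1 * ε) (by gcongr) (by positivity)
        (fun j hj => (hy j hj).trans (by gcongr; exact le_max_left _ _))
        (fun j hj => (hσ j (by omega)).trans (by
          nlinarith [le_max_right L 1]))
      have h2 := he i (by omega)
      have h3 := hσ i (by omega)
      have h4 : y i = backstepError 1 f κ i y σ + virtualControl 1 f κ i y σ + σ i := by
        simp only [backstepError]; ring
      have h5 : |y i| ≤ (2 + K * max L 1) * ε := by
        rw [h4]
        calc _ ≤ |backstepError 1 f κ i y σ| + |virtualControl 1 f κ i y σ| + |σ i| :=
              abs_add_three _ _ _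
          _ ≤ ε + K * (max L 1 * ε) + ε := by gcongr
          _ = _ := by ring
      exact h5.trans (by gcongr; exact le_max_right _ _)

/-- The next error equals the current error times the gain minus its threshold, so positivity passes
from stage to stage. -/
theorem GainCondition.backstepError_pos {N : ℕ} {β : ℝ} {f : (i : ℕ) → (Fin (i + 1) → ℝ) → ℝ}
    {κ y σ : ℕ → ℝ} (h : GainCondition N β f κ y σ) (h0 : 0 < backstepError β f κ 0 y σ) (i : ℕ) :
    i < N → 0 < backstepError β f κ i y σ := by
  induction i with
  | zero => exact fun _ => h0
  | succ i ih =>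
    intro hi
    have hp := ih (by omega)
    have hg := (le_max_right _ _).trans_lt (h.1 i hi)
    rw [gainThreshold, one_div, inv_mul_lt_iff₀ (show 0 < β * y i - virtualControl β f κ i y σ - σ i from hp)] at hg
    rw [backstepError_succ]
    change _ < backstepError β f κ i y σ * κ i at hg
    linarith

theorem GainCondition.one_lt {N : ℕ} {β : ℝ} {f : (i : ℕ) → (Fin (i + 1) → ℝ) → ℝ}
    {κ y σ : ℕ → ℝ} (h : GainCondition N β f κ y σ) {i : ℕ} (hi : i < N) : 1 < κ i := by
  rcases Nat.lt_or_ge (i + 1) N with h' | h'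
  · linarith [(le_max_left _ _).trans_lt (h.1 i h')]
  · rw [show i = N - 1 by omega]
    exact h.2

/-! ### The cascade of order `n + m` and its regularity. -/

/-- The nonlinearities of the cascade of the `Y`-subsystem and the scaled `X`-subsystem. -/
noncomputable def cascade (n : ℕ) (b : ℝ) (ψ φ : (i : ℕ) → (Fin (i + 1) → ℝ) → ℝ) :
    (i : ℕ) → (Fin (i + 1) → ℝ) → ℝ :=
  fun i a => if h : i < n then ψ i a
    else b * φ (i - n) fun j => b⁻¹ * a ⟨n + j, by omega⟩

/-- The gains of the cascade. -/
def cascadeGain (n : ℕ) (k c : ℕ → ℝ) : ℕ → ℝ := fun i => if i < n then k i else c (i - n)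

section Cascade

variable {n m : ℕ} {b : ℝ} {ψ φ : (i : ℕ) → (Fin (i + 1) → ℝ) → ℝ} {k c : ℕ → ℝ}

theorem cascade_of_lt {i : ℕ} (hi : i < n) : cascade n b ψ φ i = ψ i := by
  funext a
  simp [cascade, hi]

theorem cascade_add (j : ℕ) (v : ℕ → ℝ) :
    cascade n b ψ φ (n + j) (firstEntries (n + j) v)
      = b * φ j (firstEntries j fun l => b⁻¹ * v (n + l)) := by
  -- The type of the argument of `φ i` depends on `i`, so `n + j - n = j` cannot simply be
  -- rewritten.
  have key : ∀ i, i = j → ∀ g : ℕ → ℝ, φ i (fun l => g l) = φ j fun l => g l := by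
    rintro i rfl g; rfl
  simp only [cascade, Nat.not_lt.2 (Nat.le_add_right n j), dite_false, firstEntries]
  rw [key (n + j - n) (by omega) fun l => b⁻¹ * v (n + l)]
  rfl

theorem contDiff_cascade
    (hψ : ∀ i, i < n → ContDiff ℝ ((n + m - (i + 1) : ℕ) : WithTop ℕ∞) (ψ i))
    (hφ : ∀ j, j < m → ContDiff ℝ ((m - (j + 1) : ℕ) : WithTop ℕ∞) (φ j)) :
    ∀ i < n + m, ContDiff ℝ ((n + m - (i + 1) : ℕ) : WithTop ℕ∞) (cascade n b ψ φ i) := by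
  intro i hi
  by_cases h : i < n
  · rw [cascade_of_lt h]
    exact hψ i h
  · have h1 : n + m - (i + 1) = m - (i - n + 1) := by omega
    have h2 : cascade n b ψ φ i
        = fun a => b * φ (i - n) fun j => b⁻¹ * a ⟨n + j, by omega⟩ := by
      funext a
      simp only [cascade, h, dite_false]
    rw [h1, h2]
    exact contDiff_const.mul ((hφ (i - n) (by omega)).comp
      (contDiff_pi.2 fun j => contDiff_const.mul (contDiff_apply ℝ ℝ _)))

theorem cascade_zero (hψ : ∀ i, i < n → ψ i 0 = 0) (hφ : ∀ j, j < m → φ j 0 = 0) :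
    ∀ i < n + m, cascade n b ψ φ i 0 = 0 := by
  intro i hi
  by_cases h : i < n
  · rw [cascade_of_lt h]
    exact hψ i h
  · have := hφ (i - n) (by omega)
    simp only [cascade, h, dite_false, Pi.zero_apply, mul_zero]
    exact mul_eq_zero_of_right _ this

theorem virtualControl_cascade {i : ℕ} (hi : i ≤ n) :
    virtualControl 1 (cascade n b ψ φ) (cascadeGain n k c) i = virtualControl 1 ψ k i :=
  virtualControl_congr i (fun j hj => cascade_of_lt (by omega))
    fun j hj => by simp [cascadeGain, show j < n by omega]

end Cascade

/-- Every integrator gains one derivative, starting from mere continuity of the last state. Nothing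
is asked of the input, which avoids circularity: the control law contains derivatives of `Δ`, whose
existence is to be proved. -/
theorem contDiffOn_state {f : (i : ℕ) → (Fin (i + 1) → ℝ) → ℝ} {N : ℕ} {y : ℕ → ℝ → ℝ} {s : Set ℝ}
    (hs : UniqueDiffOn ℝ s)
    (hf : ∀ i < N, ContDiff ℝ ((N - (i + 1) : ℕ) : WithTop ℕ∞) (f i))
    (hy : ∀ i < N, ∀ t ∈ s, HasDerivWithinAt (y i)
      (y (i + 1) t + f i (firstEntries i fun l => y l t)) s t) {r : ℕ} :
    ∀ {i : ℕ}, i + r < N → ContDiffOn ℝ r (y i) s := by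
  induction r with
  | zero =>
    intro i hi
    exact contDiffOn_zero.2 fun t ht => (hy i (by omega) t ht).continuousWithinAt
  | succ r ih =>
    intro i hi
    refine contDiffOn_succ_of_hasDerivWithinAt hs (hy i (by omega)) ((ih (by omega)).add ?_)
    exact ((hf i (by omega)).of_le (by exact_mod_cast (by omega : r ≤ N - (i + 1)))).comp_contDiffOn
      (contDiffOn_pi.2 fun j => ih (by omega))

theorem hasDerivWithinAt_jet_add {N : ℕ} {g : ℝ → ℝ} (hg : ContDiffOn ℝ N g (Set.Ici 0)) {D : ℝ}
    (hD : 0 ≤ D) {i : ℕ} (hi : i < N) {t : ℝ} (ht : 0 ≤ t) :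
    HasDerivWithinAt (fun τ => jet g (τ + D) i) (jet g (t + D) (i + 1)) (Set.Ici 0) t := by
  have h1 : HasDerivWithinAt (fun τ => τ + D) 1 (Set.Ici 0) t :=
    ((hasDerivAt_id t).add_const D).hasDerivWithinAt
  have h := (hasDerivWithinAt_jet hg hi (add_nonneg ht hD)).comp t h1
    (fun τ hτ => add_nonneg hτ hD)
  rw [mul_one] at h
  exact h

theorem contDiffOn_jet_add {N : ℕ} {g : ℝ → ℝ} (hg : ContDiffOn ℝ N g (Set.Ici 0)) {D : ℝ}
    (hD : 0 ≤ D) {i r : ℕ} (hi : i + r ≤ N) :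
    ContDiffOn ℝ r (fun t => jet g (t + D) i) (Set.Ici 0) :=
  (contDiffOn_jet hg hi).comp (contDiff_id.add contDiff_const).contDiffOn
    fun _ hτ => add_nonneg hτ hD

/-! ### The two-stage design as one design for the cascade. -/

section Comparison

variable {n m : ℕ} {b D : ℝ} {ψ φ : (i : ℕ) → (Fin (i + 1) → ℝ) → ℝ} {k c : ℕ → ℝ} {s Δ : ℝ → ℝ}
  {v : ℕ → ℝ → ℝ}

theorem contDiffOn_deltaSignal
    (hψ : ∀ i, i < n → ContDiff ℝ ((n + m - (i + 1) : ℕ) : WithTop ℕ∞) (ψ i))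
    (hφ : ∀ j, j < m → ContDiff ℝ ((m - (j + 1) : ℕ) : WithTop ℕ∞) (φ j))
    (hD : 0 ≤ D) (hs : ContDiffOn ℝ ((n + m : ℕ) : WithTop ℕ∞) s (Set.Ici 0))
    (hv : ∀ i < n + m, ∀ t, 0 ≤ t → HasDerivWithinAt (v i)
      (v (i + 1) t + cascade n b ψ φ i (firstEntries i fun l => v l t)) (Set.Ici 0) t)
    (hΔ : ∀ t, 0 ≤ t → Δ t = virtualControl 1 ψ k n (fun l => v l t) (jet s (t + D))
      + jet s (t + D) n) :
    ContDiffOn ℝ m Δ (Set.Ici 0) := by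
  refine ContDiffOn.congr ?_ hΔ
  refine ContDiffOn.add ?_ (contDiffOn_jet_add hs hD le_rfl)
  rw [← virtualControl_cascade (b := b) (φ := φ) (c := k) le_rfl]
  exact (smoothOfFirst_virtualControl (contDiff_cascade hψ hφ) n m le_rfl).contDiffOn
    (fun i hi => contDiffOn_state (uniqueDiffOn_Ici 0) (contDiff_cascade hψ hφ) hv (by omega))
    (fun i hi => contDiffOn_jet_add hs hD (by omega))

/-- Beyond the `Y`-subsystem, the backstepping errors of the cascade are those of the
`X`-subsystem relative to the reference `Δ`. -/
theorem backstepError_cascade_add (hb : b ≠ 0)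
    (hψ : ∀ i, i < n → ContDiff ℝ ((n + m - (i + 1) : ℕ) : WithTop ℕ∞) (ψ i))
    (hφ : ∀ j, j < m → ContDiff ℝ ((m - (j + 1) : ℕ) : WithTop ℕ∞) (φ j))
    (hD : 0 ≤ D) (hs : ContDiffOn ℝ ((n + m : ℕ) : WithTop ℕ∞) s (Set.Ici 0))
    (hv : ∀ i < n + m, ∀ t, 0 ≤ t → HasDerivWithinAt (v i)
      (v (i + 1) t + cascade n b ψ φ i (firstEntries i fun l => v l t)) (Set.Ici 0) t)
    (hΔ : ∀ t, 0 ≤ t → Δ t = virtualControl 1 ψ k n (fun l => v l t) (jet s (t + D))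
      + jet s (t + D) n) (j : ℕ) :
    j ≤ m → ∀ t, 0 ≤ t →
      backstepError 1 (cascade n b ψ φ) (cascadeGain n k c) (n + j) (fun l => v l t) (jet s (t + D))
        = backstepError b φ c j (fun l => b⁻¹ * v (n + l) t) (jet Δ t) := by
  have hΔd := contDiffOn_deltaSignal hψ hφ hD hs hv hΔ
  induction j with
  | zero =>
    intro _ t ht
    have h0 : jet Δ t 0 = Δ t := by simp [jet]
    simp only [backstepError, add_zero, virtualControl_cascade le_rfl, h0, hΔ t ht, virtualControl]
    field_simp
    ring
  | succ j ih =>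
    intro hj t ht
    have ih := ih (by omega)
    have h1 := hasDerivWithinAt_backstepError (β := 1) (κ := cascadeGain n k c)
      (contDiff_cascade (b := b) hψ hφ) (σ := fun i τ => jet s (τ + D) i)
      (fun i hi => hasDerivWithinAt_jet_add hs hD hi ht) (fun i hi => hv i hi t ht)
      (i := n + j) (by omega)
    have h2 := hasDerivWithinAt_backstepError (β := b) (κ := c) hφ
      (y := fun l τ => b⁻¹ * v (n + l) τ) (σ := fun i τ => jet Δ τ i)
      (fun i hi => hasDerivWithinAt_jet hΔd hi ht) (fun i hi => by
        refine ((hv (n + i) (by omega) t ht).const_mul b⁻¹).congr_deriv ?_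
        rw [cascade_add]
        field_simp
        rfl) (i := j) (by omega)
    -- The errors at stage `j` coincide on `[0, ∞)`, hence so do their one-sided derivatives. Both
    -- obey the chain relation with the same gain, so the next errors coincide.
    have h3 := (uniqueDiffOn_Ici (0 : ℝ) t ht).eq_deriv _ (h1.congr (fun τ hτ => (ih τ hτ).symm)
      (ih t ht).symm) h2
    have h4 := ih t ht
    have h5 : cascadeGain n k c (n + j) = c j := by simp [cascadeGain]
    rw [h5] at h3
    exact sub_left_injective (h3.trans (congrArg (fun a => backstepError b φ c (j + 1)
      (fun l => b⁻¹ * v (n + l) t) (jet Δ t) - c j * a) h4.symm))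

end Comparison

/-! ### Strict-feedback fields in coordinates. -/

theorem hasDerivWithinAt_euclidean_iff {N : ℕ} {Y : ℝ → EuclideanSpace ℝ (Fin N)}
    {Y' : EuclideanSpace ℝ (Fin N)} {s : Set ℝ} {t : ℝ} :
    HasDerivWithinAt Y Y' s t ↔ ∀ i, HasDerivWithinAt (fun τ => Y τ i) (Y' i) s t := by
  simp only [hasDerivWithinAt_iff_hasFDerivWithinAt]
  rw [hasFDerivWithinAt_euclidean]
  refine forall_congr' fun i => ?_
  have : (PiLp.proj 2 (fun _ : Fin N => ℝ) i).comp (ContinuousLinearMap.toSpanSingleton ℝ Y')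
      = ContinuousLinearMap.toSpanSingleton ℝ (Y' i) := by
    ext; simp
  rw [← this]

theorem coords_of_lt {N i : ℕ} (hi : i < N) (v : EuclideanSpace ℝ (Fin N)) :
    coords v i = v ⟨i, hi⟩ := by
  simp [coords, hi]

theorem continuous_coords {N : ℕ} (i : ℕ) :
    Continuous fun v : EuclideanSpace ℝ (Fin N) => coords v i := by
  by_cases hi : i < N
  · simp only [coords_of_lt hi]
    fun_prop
  · simp only [coords, hi, dite_false]
    fun_prop

theorem contDiff_coords {N : ℕ} {r : WithTop ℕ∞} (i : ℕ) :
    ContDiff ℝ r fun v : EuclideanSpace ℝ (Fin N) => coords v i := by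
  by_cases hi : i < N
  · simp only [coords_of_lt hi]
    fun_prop
  · simp only [coords, hi, dite_false]
    fun_prop

theorem abs_coords_le_norm {N : ℕ} (i : ℕ) (v : EuclideanSpace ℝ (Fin N)) : |coords v i| ≤ ‖v‖ := by
  by_cases hi : i < N
  · rw [coords_of_lt hi]
    exact PiLp.norm_apply_le v _
  · simp [coords, hi]

theorem norm_le_of_abs_coords_le {N : ℕ} {v : EuclideanSpace ℝ (Fin N)} {A : ℝ} (hA : 0 ≤ A)
    (h : ∀ i < N, |coords v i| ≤ A) : ‖v‖ ≤ N * A := by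
  rw [EuclideanSpace.norm_eq]
  refine Real.sqrt_le_iff.2 ⟨by positivity, ?_⟩
  have h1 : ∑ i : Fin N, ‖v i‖ ^ 2 ≤ ∑ _i : Fin N, A ^ 2 := by
    refine Finset.sum_le_sum fun i _ => ?_
    have := h i i.2
    rw [coords_of_lt i.2] at this
    exact pow_le_pow_left₀ (norm_nonneg _) this 2
  rw [Finset.sum_const, Finset.card_univ, Fintype.card_fin, nsmul_eq_mul] at h1
  have h2 : (N : ℝ) ≤ (N : ℝ) ^ 2 := by exact_mod_cast Nat.le_self_pow two_ne_zero N
  nlinarith [sq_nonneg A]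

theorem strictFeedback_apply {N i : ℕ} (hi : i < N) (f : (i : ℕ) → (Fin (i + 1) → ℝ) → ℝ)
    (y : EuclideanSpace ℝ (Fin N)) (u : ℝ) :
    strictFeedback N f y u ⟨i, hi⟩
      = (if i + 1 < N then coords y (i + 1) else u) + f i (firstEntries i (coords y)) := rfl

theorem hasDerivWithinAt_strictFeedback_iff {N : ℕ} {f : (i : ℕ) → (Fin (i + 1) → ℝ) → ℝ}
    {Y : ℝ → EuclideanSpace ℝ (Fin N)} {y : EuclideanSpace ℝ (Fin N)} {u : ℝ} {s : Set ℝ} {t : ℝ} :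
    HasDerivWithinAt Y (strictFeedback N f y u) s t ↔
      ∀ i < N, HasDerivWithinAt (fun τ => coords (Y τ) i)
        ((if i + 1 < N then coords y (i + 1) else u) + f i (firstEntries i (coords y))) s t := by
  rw [hasDerivWithinAt_euclidean_iff]
  constructor
  · intro h i hi
    simp only [coords_of_lt hi]
    exact h ⟨i, hi⟩
  · rintro h ⟨i, hi⟩
    have := h i hi
    simp only [coords_of_lt hi] at this
    exact this

/-- The direction in which the input enters a strict-feedback system. -/
def inputVector (N : ℕ) (u : ℝ) : EuclideanSpace ℝ (Fin N) :=
  WithLp.toLp 2 fun i : Fin N => if (i : ℕ) + 1 < N then 0 else u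

theorem strictFeedback_eq_add {N : ℕ} (f : (i : ℕ) → (Fin (i + 1) → ℝ) → ℝ)
    (y : EuclideanSpace ℝ (Fin N)) (u : ℝ) :
    strictFeedback N f y u = strictFeedback N f y 0 + inputVector N u := by
  ext i
  simp only [strictFeedback, inputVector, PiLp.add_apply]
  split_ifs <;> ring

theorem contDiff_strictFeedback {N : ℕ} {f : (i : ℕ) → (Fin (i + 1) → ℝ) → ℝ} {r : WithTop ℕ∞}
    (hf : ∀ i < N, ContDiff ℝ r (f i)) :
    ContDiff ℝ r fun p : EuclideanSpace ℝ (Fin N) × ℝ => strictFeedback N f p.1 p.2 := by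
  rw [contDiff_euclidean]
  rintro ⟨i, hi⟩
  simp only [strictFeedback_apply]
  refine ContDiff.add ?_ ((hf i hi).comp (contDiff_pi.2 fun j =>
    (contDiff_coords (j : ℕ)).comp contDiff_fst))
  split_ifs
  · exact (contDiff_coords _).comp contDiff_fst
  · exact contDiff_snd

/-- The input enters additively, so one Lipschitz constant serves all inputs. -/
theorem exists_lipschitzOnWith_strictFeedback {N : ℕ} {f : (i : ℕ) → (Fin (i + 1) → ℝ) → ℝ}
    (hf : ∀ i < N, ContDiff ℝ 1 (f i)) (R : ℝ) :
    ∃ K, ∀ u, LipschitzOnWith K (fun y : EuclideanSpace ℝ (Fin N) => strictFeedback N f y u)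
      (Metric.closedBall 0 R) := by
  have h1 : ContDiff ℝ 1 fun y : EuclideanSpace ℝ (Fin N) => strictFeedback N f y 0 :=
    (contDiff_strictFeedback hf).comp (contDiff_id.prodMk contDiff_const)
  obtain ⟨K, hK⟩ := (h1.locallyLipschitz.locallyLipschitzOn
    (s := Metric.closedBall 0 R)).exists_lipschitzOnWith_of_compact (isCompact_closedBall 0 R)
  refine ⟨K, fun u y hy y' hy' => ?_⟩
  simp only
  rw [strictFeedback_eq_add f y u, strictFeedback_eq_add f y' u, edist_add_right]
  exact hK hy hy'

/-! ### Integral equations and the predictor. -/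

section Integral

theorem ContinuousOn.intervalIntegrable_of_Ici {E : Type*} [NormedAddCommGroup E] {F : ℝ → E} {a : ℝ}
    (hF : ContinuousOn F (Set.Ici a)) {x y : ℝ} (hx : a ≤ x) (hy : a ≤ y) :
    IntervalIntegrable F MeasureTheory.volume x y :=
  (hF.mono fun _ hz => (le_min hx hy).trans hz.1).intervalIntegrable

variable {E : Type*} [NormedAddCommGroup E] [NormedSpace ℝ E]

theorem hasDerivWithinAt_integral_Ici [CompleteSpace E] {F : ℝ → E} {a : ℝ}
    (hF : ContinuousOn F (Set.Ici a)) {t : ℝ} (ht : a ≤ t) :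
    HasDerivWithinAt (fun u => ∫ x in a..u, F x) (F t) (Set.Ici a) t := by
  -- Freezing `F` to the left of `a` gives a continuous function on the line with the same integrals
  -- from `a`.
  have hc : Continuous fun x => F (max a x) :=
    hF.comp_continuous (by fun_prop) fun x => le_max_left a x
  have h := ((hc.integral_hasStrictDerivAt a t).hasDerivAt).hasDerivWithinAt (s := Set.Ici a)
  rw [max_eq_right ht] at h
  have h2 : ∀ u ∈ Set.Ici a, ∫ x in a..u, F x = ∫ x in a..u, F (max a x) := by
    intro u hu
    refine intervalIntegral.integral_congr fun x hx => ?_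
    rw [Set.uIcc_of_le hu] at hx
    simp only [max_eq_right hx.1]
  exact h.congr h2 (h2 t ht)

theorem integral_eq_sub_of_hasDerivWithinAt_Ici [CompleteSpace E] {P F : ℝ → E} {a : ℝ}
    (hF : ContinuousOn F (Set.Ici a))
    (hP : ∀ t, a ≤ t → HasDerivWithinAt P (F t) (Set.Ici a) t) {x y : ℝ} (hx : a ≤ x)
    (hxy : x ≤ y) : ∫ u in x..y, F u = P y - P x := by
  refine intervalIntegral.integral_eq_sub_of_hasDeriv_right_of_le hxy
    (fun t ht => (hP t (hx.trans ht.1)).continuousWithinAt.mono fun z hz => hx.trans hz.1)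
    (fun t ht => (hP t (hx.trans ht.1.le)).mono fun z hz => ?_)
    (hF.intervalIntegrable_of_Ici hx (hx.trans hxy))
  exact (hx.trans ht.1.le).trans (le_of_lt hz)

end Integral

theorem continuousOn_inputSignal {m : ℕ} {ξ : ℝ → ℝ} {X : ℝ → EuclideanSpace ℝ (Fin m)} {D : ℝ}
    (hξ : ContinuousOn ξ (Set.Icc (-D) 0)) (hX : ContinuousOn X (Set.Ici 0))
    (h0 : ξ 0 = coords (X 0) 0) : ContinuousOn (inputSignal ξ X) (Set.Ici (-D)) := by
  have h1 : ContinuousOn (inputSignal ξ X) (Set.Icc (-D) 0) :=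
    hξ.congr fun t ht => by simp [inputSignal, ht.2]
  have h2 : ContinuousOn (inputSignal ξ X) (Set.Ici 0) := by
    refine ((continuous_coords 0).comp_continuousOn hX).congr fun t ht => ?_
    rcases eq_or_lt_of_le (show (0 : ℝ) ≤ t from ht) with rfl | ht
    · simp [inputSignal, h0]
    · simp [inputSignal, not_le.2 ht]
  refine (h1.union_of_isClosed h2 isClosed_Icc isClosed_Ici).mono fun t ht => ?_
  rcases le_total t 0 with h | h
  · exact Or.inl ⟨ht, h⟩
  · exact Or.inr h

theorem inputSignal_of_nonneg {m : ℕ} {ξ : ℝ → ℝ} {X : ℝ → EuclideanSpace ℝ (Fin m)}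
    (h0 : ξ 0 = coords (X 0) 0) {t : ℝ} (ht : 0 ≤ t) : inputSignal ξ X t = coords (X t) 0 := by
  rcases eq_or_lt_of_le ht with rfl | ht
  · simp [inputSignal, h0]
  · simp [inputSignal, not_le.2 ht]

/-- The predictor reproduces the delayed state, by uniqueness of solutions. -/
theorem predictor_eq_integral {n : ℕ} {f : (i : ℕ) → (Fin (i + 1) → ℝ) → ℝ}
    (hf : ∀ i < n, ContDiff ℝ 1 (f i)) {D : ℝ} (hD : 0 < D) {u : ℝ → ℝ}
    (hu : ContinuousOn u (Set.Ici (-D))) {Y P : ℝ → EuclideanSpace ℝ (Fin n)}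
    (hY : ∀ t, 0 ≤ t → HasDerivWithinAt Y (strictFeedback n f (Y t) (u (t - D))) (Set.Ici 0) t)
    (hPc : ContinuousOn P (Set.Ici (-D)))
    (hP0 : ∀ θ ∈ Set.Icc (-D) 0, P θ = Y 0 + ∫ τ in (-D)..θ, strictFeedback n f (P τ) (u τ))
    (hP : ∀ t, 0 ≤ t → P t = Y t + ∫ τ in (t - D)..t, strictFeedback n f (P τ) (u τ)) :
    (∀ t, 0 ≤ t → Y t = P (t - D)) ∧
    ∀ θ, -D ≤ θ → HasDerivWithinAt P (strictFeedback n f (P θ) (u θ)) (Set.Ici (-D)) θ := by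
  have hF : ContinuousOn (fun τ => strictFeedback n f (P τ) (u τ)) (Set.Ici (-D)) :=
    (contDiff_strictFeedback (r := 0) fun i hi => (hf i hi).of_le (by simp)).continuous.comp_continuousOn
      (hPc.prodMk hu)
  set F := fun τ => strictFeedback n f (P τ) (u τ) with hFdef
  set G := fun θ => Y 0 + ∫ τ in (-D)..θ, F τ with hGdef
  have hG : ∀ θ, -D ≤ θ → HasDerivWithinAt G (F θ) (Set.Ici (-D)) θ := fun θ hθ =>
    (hasDerivWithinAt_integral_Ici hF hθ).const_add _
  have hYc : ContinuousOn Y (Set.Ici 0) := fun t ht => (hY t ht).continuousWithinAt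
  have hGc : ContinuousOn G (Set.Ici (-D)) := fun t ht => (hG t ht).continuousWithinAt
  -- Where `P = G` up to time `T - D`, the shift `t ↦ G (t - D)` solves the equation of `Y` on `[0,
  -- T]` with the same initial value.
  have huniq : ∀ T, 0 ≤ T → (∀ θ ∈ Set.Icc (-D) (T - D), P θ = G θ) →
      ∀ t ∈ Set.Icc 0 T, Y t = G (t - D) := by
    intro T hT hPG
    have hsub : ContinuousOn (fun t => G (t - D)) (Set.Icc 0 T) :=
      hGc.comp (by fun_prop) fun t ht => by simpa using ht.1
    obtain ⟨R₁, hR₁⟩ := isCompact_Icc.exists_bound_of_continuousOn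
      (hYc.mono (fun t ht => ht.1 : Set.Icc 0 T ⊆ Set.Ici 0))
    obtain ⟨R₂, hR₂⟩ := isCompact_Icc.exists_bound_of_continuousOn hsub
    obtain ⟨K, hK⟩ := exists_lipschitzOnWith_strictFeedback hf (max R₁ R₂)
    refine ODE_solution_unique_of_mem_Icc_right (K := K)
      (v := fun t y => strictFeedback n f y (u (t - D)))
      (s := fun _ => Metric.closedBall 0 (max R₁ R₂))
      (fun t _ => hK _) (hYc.mono Set.Icc_subset_Ici_self)
      (fun t ht => (hY t ht.1).mono (Set.Ici_subset_Ici.2 ht.1))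
      (fun t ht => mem_closedBall_zero_iff.2 ((hR₁ t ⟨ht.1, ht.2.le⟩).trans (le_max_left _ _)))
      hsub (fun t ht => ?_)
      (fun t ht => mem_closedBall_zero_iff.2 ((hR₂ t ⟨ht.1, ht.2.le⟩).trans (le_max_right _ _)))
      (by simp [hGdef])
    have h1 : HasDerivWithinAt (fun τ => τ - D) 1 (Set.Ici t) t :=
      ((hasDerivAt_id t).sub_const D).hasDerivWithinAt
    have h2 := (hG (t - D) (by linarith [ht.1])).scomp t h1
      (fun τ (hτ : t ≤ τ) => show -D ≤ τ - D by linarith [ht.1])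
    rw [one_smul] at h2
    refine h2.congr_deriv ?_
    simp only [hFdef]
    rw [hPG (t - D) ⟨by linarith [ht.1], by linarith [ht.2]⟩]
  -- Method of steps: `P = G` up to `jD` gives `Y t = G (t - D)` up to `(j + 1)D`, and the predictor
  -- formula then joins the two integrals into `G`.
  have hstep : ∀ j : ℕ, ∀ θ ∈ Set.Icc (-D) (j * D), P θ = G θ := by
    intro j
    induction j with
    | zero => simpa using hP0
    | succ j ih =>
      intro θ hθ
      push_cast at hθ
      rcases le_total θ 0 with h | h
      · exact hP0 θ ⟨hθ.1, h⟩
      · have hY' := huniq ((j + 1) * D) (by positivity)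
          (fun θ' hθ' => ih θ' ⟨hθ'.1, by linarith [hθ'.2]⟩) θ ⟨h, hθ.2⟩
        rw [hP θ h, hY', hGdef]
        simp only
        rw [add_assoc, intervalIntegral.integral_add_adjacent_intervals
          (hF.intervalIntegrable_of_Ici le_rfl (by linarith))
          (hF.intervalIntegrable_of_Ici (by linarith) (by linarith))]
  have hPG : ∀ θ, -D ≤ θ → P θ = G θ := by
    intro θ hθ
    obtain ⟨j, hj⟩ := exists_nat_ge (θ / D)
    exact hstep j θ ⟨hθ, (div_le_iff₀ hD).1 hj⟩
  refine ⟨fun t ht => ?_, fun θ hθ => (hG θ hθ).congr (fun τ hτ => hPG τ hτ) (hPG θ hθ)⟩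
  rw [hPG _ (by linarith)]
  exact huniq t ht (fun θ hθ => hPG θ hθ.1) t ⟨ht, le_rfl⟩

/-- `Y t` is itself a predictor value, so three terms are at most `A`; the `L²` norm over a window
of length `D` gives the factor `√D`. -/
theorem stateNorm_le {n m : ℕ} {D : ℝ} {ξ : ℝ → ℝ} {Y P : ℝ → EuclideanSpace ℝ (Fin n)}
    {X : ℝ → EuclideanSpace ℝ (Fin m)} {t A : ℝ} (hD : 0 ≤ D) (hA : 0 ≤ A) (hY : Y t = P (t - D))
    (hP : ∀ τ ∈ Set.Icc (t - D) t, ‖P τ‖ ≤ A)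
    (hx : ∀ τ ∈ Set.Icc (t - D) t, |inputSignal ξ X τ| ≤ A) (hX : ‖X t‖ ≤ A) :
    stateNorm D ξ Y X P t ≤ (3 + Real.sqrt D) * A := by
  have h1 : ‖Y t‖ ≤ A := hY ▸ hP _ ⟨le_rfl, by linarith⟩
  have h2 : sSup ((fun x : ℝ => ‖P (t - D + D * x)‖) '' Set.Icc 0 1) ≤ A := by
    refine Real.sSup_le ?_ hA
    rintro _ ⟨x, hx, rfl⟩
    exact hP _ ⟨by nlinarith [hx.1], by nlinarith [hx.2]⟩
  have h3 : Real.sqrt (∫ τ in (t - D)..t, inputSignal ξ X τ ^ 2) ≤ Real.sqrt D * A := by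
    rw [← Real.sqrt_sq hA, ← Real.sqrt_mul hD]
    refine Real.sqrt_le_sqrt ((le_abs_self _).trans ?_)
    have := intervalIntegral.norm_integral_le_of_norm_le_const (a := t - D) (b := t)
      (f := fun τ => inputSignal ξ X τ ^ 2) (C := A ^ 2) fun τ hτ => by
        rw [Set.uIoc_of_le (by linarith)] at hτ
        rw [norm_pow]
        exact pow_le_pow_left₀ (norm_nonneg _) (hx τ ⟨hτ.1.le, hτ.2⟩) 2
    rw [sub_sub_cancel, abs_of_nonneg hD, mul_comm] at this
    exact this
  unfold stateNorm
  linarith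

/-- With the input in slot `m`, the control law holds exactly when the last error vanishes.
Existence uses one direction, the decay estimate the other. -/
theorem backstepError_eq_mul_sub_nominalControl {m : ℕ} {b : ℝ} (hb : b ≠ 0)
    {φ : (i : ℕ) → (Fin (i + 1) → ℝ) → ℝ}
    (hφ : ∀ j < m, ContDiff ℝ ((m - (j + 1) : ℕ) : WithTop ℕ∞) (φ j)) {c : ℕ → ℝ}
    {X : EuclideanSpace ℝ (Fin m)} {x δ : ℕ → ℝ} (hx : ∀ l < m, x l = coords X l) :
    backstepError b φ c m x δ = b * (x m - nominalControl m b φ c X δ) := by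
  have h := (smoothOfFirst_virtualControl (β := b) (κ := c) hφ m 0 le_rfl).congr_first hx
    (fun j _ => rfl : ∀ j < m, δ j = δ j)
  rw [backstepError, nominalControl, h]
  field_simp
  ring

/-! ### The cascade trajectory of a closed-loop solution. -/

/-- The state of the cascade of the predicted `Y`-subsystem and the scaled `X`-subsystem, followed
by the scaled input. -/
noncomputable def cascadeState {n m : ℕ} (b : ℝ) (P : ℝ → EuclideanSpace ℝ (Fin n))
    (X : ℝ → EuclideanSpace ℝ (Fin m)) (U : ℝ → ℝ) : ℕ → ℝ → ℝ := fun i t =>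
  if i < n then coords (P t) i else if i < n + m then b * coords (X t) (i - n) else b * U t

section CascadeState

variable {n m : ℕ} {b : ℝ} {ψ φ : (i : ℕ) → (Fin (i + 1) → ℝ) → ℝ}
  {P : ℝ → EuclideanSpace ℝ (Fin n)} {X : ℝ → EuclideanSpace ℝ (Fin m)} {U : ℝ → ℝ}

theorem cascadeState_of_lt {i : ℕ} (hi : i < n) (t : ℝ) :
    cascadeState b P X U i t = coords (P t) i := by
  simp [cascadeState, hi]

theorem cascadeState_add {j : ℕ} (hj : j < m) (t : ℝ) :
    cascadeState b P X U (n + j) t = b * coords (X t) j := by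
  simp [cascadeState, hj]

theorem cascadeState_last (t : ℝ) : cascadeState b P X U (n + m) t = b * U t := by
  simp [cascadeState]

theorem hasDerivWithinAt_cascadeState (hm : 0 < m) (hb : b ≠ 0) {s : Set ℝ} {t : ℝ}
    (hP : HasDerivWithinAt P (strictFeedback n ψ (P t) (b * coords (X t) 0)) s t)
    (hX : HasDerivWithinAt X (strictFeedback m φ (X t) (U t)) s t) (i : ℕ) (hi : i < n + m) :
    HasDerivWithinAt (cascadeState b P X U i) (cascadeState b P X U (i + 1) t
      + cascade n b ψ φ i (firstEntries i fun l => cascadeState b P X U l t)) s t := by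
  by_cases h : i < n
  · have h1 := hasDerivWithinAt_strictFeedback_iff.1 hP i h
    rw [show cascadeState b P X U i = fun τ => coords (P τ) i from
      funext fun τ => cascadeState_of_lt h τ, cascade_of_lt h]
    refine h1.congr_deriv ?_
    congr 1
    · split_ifs with h2
      · rw [cascadeState_of_lt h2]
      · obtain rfl : i + 1 = n := by omega
        exact (cascadeState_add hm t).symm
    · congr 1
      funext j
      exact (cascadeState_of_lt (by omega) t).symm
  · obtain ⟨j, rfl⟩ := Nat.exists_eq_add_of_le (Nat.le_of_not_lt h)
    have hj : j < m := by omega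
    have h1 := (hasDerivWithinAt_strictFeedback_iff.1 hX j hj).const_mul b
    rw [show cascadeState b P X U (n + j) = fun τ => b * coords (X τ) j from
      funext fun τ => cascadeState_add hj τ, cascade_add]
    refine h1.congr_deriv ?_
    rw [mul_add]
    congr 1
    · split_ifs with h2
      · exact (cascadeState_add h2 t).symm
      · obtain rfl : j + 1 = m := by omega
        exact (cascadeState_last t).symm
    · congr 2
      funext l
      simp only [firstEntries]
      rw [cascadeState_add (by omega)]
      field_simp

end CascadeState

theorem deltaSignal_eq {n m : ℕ} {ψ : (i : ℕ) → (Fin (i + 1) → ℝ) → ℝ} {k : ℕ → ℝ} {D : ℝ}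
    {s : ℝ → ℝ} {P : ℝ → EuclideanSpace ℝ (Fin n)} {v : ℕ → ℝ} {t : ℝ}
    (hψ : ∀ i, i < n → ContDiff ℝ ((n + m - (i + 1) : ℕ) : WithTop ℕ∞) (ψ i))
    (hv : ∀ i < n, coords (P t) i = v i) :
    deltaSignal n ψ k D s P t = virtualControl 1 ψ k n v (jet s (t + D)) + jet s (t + D) n := by
  have hψ' : ∀ i < n, ContDiff ℝ ((n - (i + 1) : ℕ) : WithTop ℕ∞) (ψ i) := fun i hi =>
    (hψ i hi).of_le (by exact_mod_cast (by omega : n - (i + 1) ≤ n + m - (i + 1)))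
  rw [deltaSignal, deltaAt, (smoothOfFirst_virtualControl (β := 1) (κ := k) hψ' n 0
    le_rfl).congr_first hv fun _ _ => rfl]

/-! ### Existence of closed-loop solutions. -/

section ClosedLoop

variable {n m : ℕ} {ψ φ : (i : ℕ) → (Fin (i + 1) → ℝ) → ℝ} {b D : ℝ} {k c : ℕ → ℝ} {s ξ : ℝ → ℝ}
  {Y₀ : EuclideanSpace ℝ (Fin n)} {X₀ : EuclideanSpace ℝ (Fin m)}
  {P₀ : ℝ → EuclideanSpace ℝ (Fin n)}

theorem continuousOn_strictFeedback (hψ : ∀ i < n, ContDiff ℝ 1 (ψ i)) {S : Set ℝ}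
    {P : ℝ → EuclideanSpace ℝ (Fin n)} {u : ℝ → ℝ} (hP : ContinuousOn P S)
    (hu : ContinuousOn u S) : ContinuousOn (fun τ => strictFeedback n ψ (P τ) (u τ)) S :=
  (contDiff_strictFeedback hψ).continuous.comp_continuousOn (hP.prodMk hu)

theorem IsInitialPredictor.eq_integral (hP₀ : IsInitialPredictor n ψ b D Y₀ ξ P₀)
    {P : ℝ → EuclideanSpace ℝ (Fin n)} {X : ℝ → EuclideanSpace ℝ (Fin m)}
    (hP : ∀ θ ∈ Set.Icc (-D) 0, P θ = P₀ θ) {θ : ℝ} (hθ : θ ∈ Set.Icc (-D) 0) :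
    P θ = Y₀ + ∫ τ in (-D)..θ, strictFeedback n ψ (P τ) (b * inputSignal ξ X τ) := by
  rw [hP θ hθ, hP₀.integral_eq θ hθ]
  congr 1
  refine intervalIntegral.integral_congr fun τ hτ => ?_
  rw [Set.uIcc_of_le hθ.1] at hτ
  simp only [inputSignal, hτ.2.trans hθ.2, if_true, hP τ ⟨hτ.1, hτ.2.trans hθ.2⟩]

theorem IsClosedLoopSolution.predictor_ode (hψ : ∀ i < n, ContDiff ℝ 1 (ψ i)) (hD : 0 < D)
    (hξ : ContinuousOn ξ (Set.Icc (-D) 0)) (hξ0 : ξ 0 = coords X₀ 0)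
    (hP₀ : IsInitialPredictor n ψ b D Y₀ ξ P₀)
    {Y P : ℝ → EuclideanSpace ℝ (Fin n)} {X : ℝ → EuclideanSpace ℝ (Fin m)}
    (h : IsClosedLoopSolution n m ψ φ b D k c s Y₀ X₀ ξ P₀ Y X P) :
    (∀ t, 0 ≤ t → Y t = P (t - D)) ∧ ∀ t, 0 ≤ t →
      HasDerivWithinAt P (strictFeedback n ψ (P t) (b * coords (X t) 0)) (Set.Ici 0) t := by
  have hX : ContinuousOn X (Set.Ici 0) := fun t ht => (h.ode_X t ht).continuousWithinAt
  have hx0 : ξ 0 = coords (X 0) 0 := by rw [hξ0, h.init_X]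
  have key := predictor_eq_integral hψ hD (u := fun τ => b * inputSignal ξ X τ)
    (continuousOn_const.mul (continuousOn_inputSignal hξ hX hx0)) h.ode_Y h.continuousOn_P
    (fun θ hθ => by rw [h.init_Y]; exact hP₀.eq_integral h.init_P hθ) h.predictor
  refine ⟨key.1, fun t ht => ?_⟩
  have h1 := (key.2 t (by linarith)).mono (Set.Ici_subset_Ici.2 (show -D ≤ 0 by linarith))
  rwa [inputSignal_of_nonneg hx0 ht] at h1

/-- In error coordinates the closed loop is linear, hence globally solvable for arbitrary gains; the
states are recovered through the triangular inverse. -/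
theorem exists_isClosedLoopSolution (hm : 0 < m)
    (hψ : ∀ i, i < n → ContDiff ℝ ((n + m - (i + 1) : ℕ) : WithTop ℕ∞) (ψ i))
    (hφ : ∀ j, j < m → ContDiff ℝ ((m - (j + 1) : ℕ) : WithTop ℕ∞) (φ j))
    (hb : b ≠ 0) (hD : 0 < D) (hs : ContDiffOn ℝ ((n + m : ℕ) : WithTop ℕ∞) s (Set.Ici 0))
    (hξ : ContinuousOn ξ (Set.Icc (-D) 0)) (hξ0 : ξ 0 = coords X₀ 0)
    (hP₀ : IsInitialPredictor n ψ b D Y₀ ξ P₀) :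
    ∃ Y X P, IsClosedLoopSolution n m ψ φ b D k c s Y₀ X₀ ξ P₀ Y X P := by
  have hψ1 : ∀ i < n, ContDiff ℝ 1 (ψ i) := fun i hi =>
    (hψ i hi).of_le (by exact_mod_cast (by omega : 1 ≤ n + m - (i + 1)))
  have hθ := contDiff_cascade (b := b) hψ hφ
  set a : ℕ → ℝ := fun i =>
    cascadeState b (fun _ => P₀ 0) (fun _ => X₀) (fun _ => 0) i 0 with ha
  obtain ⟨z, hz0, -, hz, hzN⟩ := exists_linearChain (n + m) (cascadeGain n k c) fun i =>
    backstepError 1 (cascade n b ψ φ) (cascadeGain n k c) i a (jet s (0 + D))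
  -- One entry more than the number of states: entry `n + m` is the scaled input, fixed by `z_{n+m}
  -- = 0`.
  choose y hy using fun t => exists_state_of_backstepError (κ := cascadeGain n k c) hθ
    (fun i => z i t) (jet s (t + D)) (n + m + 1) le_rfl
  have hv : ∀ i < n + m, ∀ t, 0 ≤ t → HasDerivWithinAt (fun τ => y τ i)
      (y t (i + 1) + cascade n b ψ φ i (firstEntries i fun l => y t l)) (Set.Ici 0) t :=
    fun i hi t ht => hasDerivWithinAt_of_backstepError (κ := cascadeGain n k c)
      (y := fun i τ => y τ i) (σ := fun i τ => jet s (τ + D) i) hθ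
      (fun j hj => (hz j hj t).hasDerivWithinAt)
      (fun j hj => hasDerivWithinAt_jet_add hs hD.le hj ht)
      (fun i hi τ => hy τ i (Nat.lt_succ_of_le hi)) i hi
  have hy0 : ∀ i, i < n + m → y 0 i = a i := by
    intro i
    induction i using Nat.strong_induction_on with
    | _ i ih =>
      intro hi
      rw [hy 0 i (by omega), hz0 i hi, (smoothOfFirst_virtualControl hθ i 0
        (by omega)).congr_first (fun j hj => ih j hj (hj.trans hi)) fun _ _ => rfl, backstepError]
      ring
  set P : ℝ → EuclideanSpace ℝ (Fin n) := fun t =>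
    if t ≤ 0 then P₀ t else WithLp.toLp 2 fun i : Fin n => y t i with hPdef
  set X : ℝ → EuclideanSpace ℝ (Fin m) := fun t =>
    WithLp.toLp 2 fun j : Fin m => b⁻¹ * y t (n + j) with hXdef
  have hcP : ∀ t, 0 ≤ t → ∀ i < n, coords (P t) i = y t i := by
    intro t ht i hi
    rcases eq_or_lt_of_le ht with rfl | ht
    · rw [hy0 i (by omega)]
      simp [hPdef, ha, cascadeState_of_lt hi]
    · simp [hPdef, not_le.2 ht, coords_of_lt hi]
  have hcX : ∀ t, ∀ j < m, coords (X t) j = b⁻¹ * y t (n + j) := by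
    intro t j hj
    simp [hXdef, coords_of_lt hj]
  have hX0 : X 0 = X₀ := by
    ext j
    have := hcX 0 j j.2
    rw [coords_of_lt j.2, hy0 _ (by omega)] at this
    simp only [ha] at this
    rw [cascadeState_add j.2, coords_of_lt j.2] at this
    rw [this]
    field_simp
  have hXode : ∀ t, 0 ≤ t → HasDerivWithinAt X
      (strictFeedback m φ (X t) (b⁻¹ * y t (n + m))) (Set.Ici 0) t := by
    intro t ht
    refine hasDerivWithinAt_strictFeedback_iff.2 fun j hj => ?_
    simp only [hcX _ j hj]
    refine ((hv (n + j) (by omega) t ht).const_mul b⁻¹).congr_deriv ?_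
    rw [cascade_add, mul_add, inv_mul_cancel_left₀ hb]
    congr 1
    · split_ifs with h
      · exact (hcX t _ h).symm
      · rw [show m = j + 1 by omega]; rfl
    · congr 1
      funext l
      exact (hcX t l (by omega)).symm
  have hPode : ∀ t, 0 ≤ t → HasDerivWithinAt P
      (strictFeedback n ψ (P t) (b * coords (X t) 0)) (Set.Ici 0) t := by
    intro t ht
    refine hasDerivWithinAt_strictFeedback_iff.2 fun i hi => ?_
    refine ((hv i (by omega) t ht).congr (fun τ hτ => hcP τ hτ i hi) (hcP t ht i hi)).congr_deriv ?_
    rw [cascade_of_lt hi]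
    congr 1
    · split_ifs with h
      · exact (hcP t ht _ h).symm
      · rw [hcX t 0 hm, mul_inv_cancel_left₀ hb, show i + 1 = n by omega]; rfl
    · congr 1
      funext l
      exact (hcP t ht l (by omega)).symm
  -- The input recovered from the vanishing last error of the cascade is the nominal control, by the
  -- comparison of the two designs.
  have hU : ∀ t, 0 ≤ t → b⁻¹ * y t (n + m)
      = nominalControl m b φ c (X t) (jet (deltaSignal n ψ k D s P) t) := by
    intro t ht
    have h1 := backstepError_cascade_add (k := k) (c := c) hb hψ hφ hD.le hs (v := fun i τ => y τ i) hv
      (fun t ht => deltaSignal_eq hψ (hcP t ht)) m le_rfl t ht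
    rw [backstepError_eq_mul_sub_nominalControl hb hφ fun l hl => (hcX t l hl).symm] at h1
    have h2 : backstepError 1 (cascade n b ψ φ) (cascadeGain n k c) (n + m) (fun l => y t l)
        (jet s (t + D)) = 0 := by
      rw [backstepError, one_mul, hy t (n + m) (by omega), hzN t]
      ring
    rw [h2, eq_comm, mul_eq_zero, or_iff_right hb, sub_eq_zero] at h1
    exact h1
  have hPP₀ : ∀ θ ∈ Set.Icc (-D) 0, P θ = P₀ θ := fun θ hθ => by simp [hPdef, hθ.2]
  have hPc : ContinuousOn P (Set.Ici (-D)) := by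
    refine ((hP₀.continuousOn.congr hPP₀).union_of_isClosed
      (fun t ht => (hPode t ht).continuousWithinAt) isClosed_Icc
      (isClosed_Ici (a := (0 : ℝ)))).mono fun t ht => ?_
    rcases le_total t 0 with h | h
    · exact Or.inl ⟨ht, h⟩
    · exact Or.inr h
  have hx0 : ξ 0 = coords (X 0) 0 := by rw [hξ0, hX0]
  have hF : ContinuousOn (fun τ => strictFeedback n ψ (P τ) (b * inputSignal ξ X τ))
      (Set.Ici (-D)) := continuousOn_strictFeedback hψ1 hPc (continuousOn_const.mul
    (continuousOn_inputSignal hξ (fun t ht => (hXode t ht).continuousWithinAt) hx0))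
  have hPint : ∀ θ, -D ≤ θ →
      P θ = Y₀ + ∫ τ in (-D)..θ, strictFeedback n ψ (P τ) (b * inputSignal ξ X τ) := by
    intro θ hθ
    rcases le_total θ 0 with h | h
    · exact hP₀.eq_integral hPP₀ ⟨hθ, h⟩
    · have h1 := hP₀.eq_integral (X := X) hPP₀ (θ := 0) ⟨by linarith, le_rfl⟩
      have h2 := integral_eq_sub_of_hasDerivWithinAt_Ici (P := P)
        (hF.mono (Set.Ici_subset_Ici.2 (show -D ≤ 0 by linarith)))
        (fun t ht => by
          rw [inputSignal_of_nonneg hx0 ht]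
          exact hPode t ht) le_rfl h
      rw [← intervalIntegral.integral_add_adjacent_intervals
        (hF.intervalIntegrable_of_Ici le_rfl (by linarith : -D ≤ 0))
        (hF.intervalIntegrable_of_Ici (by linarith) hθ), h2, ← add_assoc, ← h1]
      abel
  have hPd : ∀ θ, -D ≤ θ → HasDerivWithinAt P
      (strictFeedback n ψ (P θ) (b * inputSignal ξ X θ)) (Set.Ici (-D)) θ := fun θ hθ =>
    ((hasDerivWithinAt_integral_Ici hF hθ).const_add Y₀).congr (fun τ hτ => hPint τ hτ)
      (hPint θ hθ)
  -- The plant state is defined as the delayed predictor, so the predictor formula is the integrated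
  -- equation of `P`.
  refine ⟨fun t => P (t - D), X, P, ?_, hX0, fun t ht => ?_, fun t ht => ?_, hPP₀, hPc,
    fun t ht => ?_⟩
  · have := hPint (-D) le_rfl
    simpa using this
  · have h1 : HasDerivWithinAt (fun τ => τ - D) 1 (Set.Ici 0) t :=
      ((hasDerivAt_id t).sub_const D).hasDerivWithinAt
    have h2 := (hPd (t - D) (by linarith)).scomp t h1
      (fun τ (hτ : 0 ≤ τ) => show -D ≤ τ - D by linarith)
    rw [one_smul] at h2
    exact h2
  · rw [← hU t ht]
    exact hXode t ht
  · rw [integral_eq_sub_of_hasDerivWithinAt_Ici hF hPd (by linarith) (by linarith)]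
    abel

end ClosedLoop

/-! ### Positivity and decay of the errors in the closed loop. -/

theorem backstepError_congr {β : ℝ} {f : (i : ℕ) → (Fin (i + 1) → ℝ) → ℝ} {κ : ℕ → ℝ} {N : ℕ}
    (hf : ∀ i < N, ContDiff ℝ ((N - (i + 1) : ℕ) : WithTop ℕ∞) (f i)) {i : ℕ} (hi : i < N)
    {y y' : ℕ → ℝ} (hy : ∀ j < N, y j = y' j) (σ : ℕ → ℝ) :
    backstepError β f κ i y σ = backstepError β f κ i y' σ := by
  rw [backstepError, backstepError, hy i hi, (smoothOfFirst_virtualControl hf i 0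
    hi.le).congr_first (fun j hj => hy j (hj.trans hi)) fun _ _ => rfl]

section ClosedLoop

variable {n m : ℕ} {ψ φ : (i : ℕ) → (Fin (i + 1) → ℝ) → ℝ} {b D : ℝ} {k c : ℕ → ℝ} {s ξ : ℝ → ℝ}
  {Y₀ : EuclideanSpace ℝ (Fin n)} {X₀ : EuclideanSpace ℝ (Fin m)}
  {P₀ : ℝ → EuclideanSpace ℝ (Fin n)}
  {Y P : ℝ → EuclideanSpace ℝ (Fin n)} {X : ℝ → EuclideanSpace ℝ (Fin m)}

/-- The backstepping errors of the cascade are nonnegative and decay exponentially along solutions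
of the closed loop. -/
theorem IsClosedLoopSolution.error_nonneg_decay (hm : 0 < m)
    (hψ : ∀ i, i < n → ContDiff ℝ ((n + m - (i + 1) : ℕ) : WithTop ℕ∞) (ψ i))
    (hφ : ∀ j, j < m → ContDiff ℝ ((m - (j + 1) : ℕ) : WithTop ℕ∞) (φ j))
    (hb : b ≠ 0) (hD : 0 < D) (hs : ContDiffOn ℝ ((n + m : ℕ) : WithTop ℕ∞) s (Set.Ici 0))
    (h : IsClosedLoopSolution n m ψ φ b D k c s Y₀ X₀ ξ P₀ Y X P)
    (hP : ∀ t, 0 ≤ t →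
      HasDerivWithinAt P (strictFeedback n ψ (P t) (b * coords (X t) 0)) (Set.Ici 0) t)
    (hsP : s D < coords (P₀ 0) 0) (hΔ : deltaAt n ψ k D s (P₀ 0) 0 < b * coords X₀ 0)
    (hk : GainCondition n 1 ψ k (coords (P₀ 0)) (jet s D)) :
    ContDiffOn ℝ (m : WithTop ℕ∞) (deltaSignal n ψ k D s P) (Set.Ici 0) ∧
    (GainCondition m b φ c (coords X₀) (jet (deltaSignal n ψ k D s P) 0) →
      ∃ v : ℕ → ℝ → ℝ, (∀ t, ∀ i < n, v i t = coords (P t) i) ∧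
        (∀ t, ∀ j < m, v (n + j) t = b * coords (X t) j) ∧
        ∃ C, 0 ≤ C ∧ ∀ i < n + m, ∀ t, 0 ≤ t →
          0 ≤ backstepError 1 (cascade n b ψ φ) (cascadeGain n k c) i (fun l => v l t)
            (jet s (t + D)) ∧
          backstepError 1 (cascade n b ψ φ) (cascadeGain n k c) i (fun l => v l t)
            (jet s (t + D)) ≤ C * Real.exp (-t)) := by
  set U : ℝ → ℝ := fun t =>
    nominalControl m b φ c (X t) (jet (deltaSignal n ψ k D s P) t) with hU
  set v := cascadeState b P X U with hvdef
  have hψn : ∀ i < n, ContDiff ℝ ((n - (i + 1) : ℕ) : WithTop ℕ∞) (ψ i) := fun i hi =>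
    (hψ i hi).of_le (by exact_mod_cast (by omega : n - (i + 1) ≤ n + m - (i + 1)))
  have hP0 : P 0 = P₀ 0 := h.init_P 0 ⟨by linarith, le_rfl⟩
  have hvP : ∀ t, ∀ i < n, v i t = coords (P t) i := fun t i hi => cascadeState_of_lt hi t
  have hvX : ∀ t, ∀ j < m, v (n + j) t = b * coords (X t) j := fun t j hj => cascadeState_add hj t
  have hv : ∀ i < n + m, ∀ t, 0 ≤ t → HasDerivWithinAt (v i)
      (v (i + 1) t + cascade n b ψ φ i (firstEntries i fun l => v l t)) (Set.Ici 0) t :=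
    fun i hi t ht => hasDerivWithinAt_cascadeState hm hb (hP t ht) (h.ode_X t ht) i hi
  have hΔv : ∀ t, 0 ≤ t → deltaSignal n ψ k D s P t
      = virtualControl 1 ψ k n (fun l => v l t) (jet s (t + D)) + jet s (t + D) n :=
    fun t _ => deltaSignal_eq hψ fun i hi => (hvP t i hi).symm
  refine ⟨contDiffOn_deltaSignal hψ hφ hD.le hs hv hΔv, fun hc => ⟨v, hvP, hvX, ?_⟩⟩
  have hcomp := backstepError_cascade_add (c := c) hb hψ hφ hD.le hs hv hΔv
  have hlast : ∀ t, 0 ≤ t → backstepError 1 (cascade n b ψ φ) (cascadeGain n k c) (n + m)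
      (fun l => v l t) (jet s (t + D)) = 0 := by
    intro t ht
    rw [hcomp m le_rfl t ht, backstepError_eq_mul_sub_nominalControl (X := X t) hb hφ]
    · rw [hvdef, cascadeState_last, inv_mul_cancel_left₀ hb, hU, sub_self, mul_zero]
    · intro l hl
      rw [hvX t l hl, inv_mul_cancel_left₀ hb]
  -- Stages below `n` come from the thresholds on `k`, starting at (a) for `θ = 0`; later stages
  -- come from those on `c`, starting at (b), after passing to the errors relative to `Δ`.
  have hinit : ∀ i < n + m, 0 < backstepError 1 (cascade n b ψ φ) (cascadeGain n k c) i
      (fun l => v l 0) (jet s (0 + D)) := by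
    intro i hi
    by_cases hin : i < n
    · have h1 := hk.backstepError_pos (by
        simp only [backstepError, virtualControl, jet, iteratedDerivWithin_zero]
        linarith) i hin
      rw [backstepError_congr (y' := fun l => v l 0) hψn hin
        fun j hj => by rw [hvP 0 j hj, hP0]] at h1
      rw [zero_add]
      simpa only [backstepError, virtualControl_cascade hin.le] using h1
    · obtain ⟨j, rfl⟩ := Nat.exists_eq_add_of_le (Nat.le_of_not_lt hin)
      have hj : j < m := by omega
      have h1 := hc.backstepError_pos (by
        simp only [backstepError, virtualControl, jet, iteratedDerivWithin_zero, deltaSignal, hP0]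
        linarith) j hj
      rw [hcomp j hj.le 0 le_rfl]
      rwa [backstepError_congr (y' := fun l => b⁻¹ * v (n + l) 0) hφ hj fun l hl => by
        rw [hvX 0 l hl, inv_mul_cancel_left₀ hb, h.init_X]] at h1
  have hgain : ∀ i < n + m, 1 < cascadeGain n k c i := by
    intro i hi
    simp only [cascadeGain]
    split_ifs with hin
    · exact hk.one_lt hin
    · exact hc.one_lt (by omega)
  have hdecay := linearChain_nonneg_decay (N := n + m) (κ := cascadeGain n k c)
    (z := fun i t => backstepError 1 (cascade n b ψ φ) (cascadeGain n k c) i (fun l => v l t)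
      (jet s (t + D))) hgain
    (fun i hi t ht => hasDerivWithinAt_backstepError (σ := fun i τ => jet s (τ + D) i)
      (contDiff_cascade hψ hφ) (fun j hj => hasDerivWithinAt_jet_add hs hD.le hj ht)
      (fun j hj => hv j hj t ht) hi)
    hlast (fun i hi => (hinit i hi).le)
  have hdecay' : ∀ i, ∃ C, 0 ≤ C ∧ (i < n + m → ∀ t, 0 ≤ t →
      0 ≤ backstepError 1 (cascade n b ψ φ) (cascadeGain n k c) i (fun l => v l t)
        (jet s (t + D)) ∧
      backstepError 1 (cascade n b ψ φ) (cascadeGain n k c) i (fun l => v l t)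
        (jet s (t + D)) ≤ C * Real.exp (-t)) := by
    intro i
    by_cases hi : i < n + m
    · obtain ⟨C, hC, hb⟩ := hdecay (n + m - i) i (by omega)
      exact ⟨C, hC, fun _ => hb⟩
    · exact ⟨0, le_rfl, fun h => absurd h hi⟩
  choose C hC hCb using hdecay'
  refine ⟨∑ i ∈ Finset.range (n + m), C i, Finset.sum_nonneg fun i _ => hC i, fun i hi t ht =>
    ⟨(hCb i hi t ht).1, (hCb i hi t ht).2.trans ?_⟩⟩
  gcongr
  exact Finset.single_le_sum (fun i _ => hC i) (Finset.mem_range.2 hi)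

end ClosedLoop

theorem jet_eq_zero {s : ℝ → ℝ} (hs : ∀ t, 0 ≤ t → s t = 0) {t : ℝ} (ht : 0 ≤ t) (i : ℕ) :
    jet s t i = 0 := by
  have h : Set.EqOn s (fun _ => 0) (Set.Ici 0) := hs
  rw [jet, iteratedDerivWithin_congr h ht, iteratedDerivWithin_fun_const_zero]

/-! ### The main theorem. -/

theorem theorem1 (n m : ℕ) (hn : 0 < n) (hm : 0 < m)
    (ψ φ : (i : ℕ) → (Fin (i + 1) → ℝ) → ℝ)
    (hψ : ∀ i, i < n → ContDiff ℝ ((n + m - (i + 1) : ℕ) : WithTop ℕ∞) (ψ i) ∧ ψ i 0 = 0)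
    (hφ : ∀ j, j < m → ContDiff ℝ ((m - (j + 1) : ℕ) : WithTop ℕ∞) (φ j) ∧ φ j 0 = 0)
    (b D : ℝ) (hb : b ≠ 0) (hD : 0 < D) (k c : ℕ → ℝ) :
    -- the decay rate `rate` and the ultimate bound `γ` do not depend on `s` or the initial data
    ∃ rate : ℝ, 0 < rate ∧ ∃ γ : ℝ → ℝ,
      ∀ (s : ℝ → ℝ), ContDiffOn ℝ ((n + m : ℕ) : WithTop ℕ∞) s (Set.Ici 0) →
      ∀ (Y₀ : EuclideanSpace ℝ (Fin n)) (X₀ : EuclideanSpace ℝ (Fin m)) (ξ : ℝ → ℝ)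
        (P₀ : ℝ → EuclideanSpace ℝ (Fin n)),
      ContDiffOn ℝ ((m - 1 : ℕ) : WithTop ℕ∞) ξ (Set.Icc (-D) 0) → ξ 0 = coords X₀ 0 →
      IsInitialPredictor n ψ b D Y₀ ξ P₀ →
      (∀ θ ∈ Set.Icc (-D) 0, s (θ + D) < coords (P₀ θ) 0) →
      deltaAt n ψ k D s (P₀ 0) 0 < b * coords X₀ 0 →
      GainCondition n 1 ψ k (coords (P₀ 0)) (jet s D) →
      (∃ Y X P, IsClosedLoopSolution n m ψ φ b D k c s Y₀ X₀ ξ P₀ Y X P) ∧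
      ∀ Y X P, IsClosedLoopSolution n m ψ φ b D k c s Y₀ X₀ ξ P₀ Y X P →
        -- the derivatives of `Δ` that enter the control law exist
        ContDiffOn ℝ (m : WithTop ℕ∞) (deltaSignal n ψ k D s P) (Set.Ici 0) ∧
        (GainCondition m b φ c (coords X₀) (jet (deltaSignal n ψ k D s P) 0) →
          -- exponential tracking
          (∃ C : ℝ, ∀ t, 0 ≤ t → |coords (Y t) 0 - s t| ≤ C * Real.exp (-rate * t)) ∧
          -- boundedness of the state norm
          ((∃ M : ℝ, ∀ t, 0 ≤ t → ∀ i, i < n + m → |jet s t i| ≤ M) →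
            ∃ C : ℝ, ∀ t, 0 ≤ t → stateNorm D ξ Y X P t ≤ C) ∧
          -- the ultimate bound depends on the target trajectory only
          (∃ T : ℝ, ∀ t, T ≤ t → 0 ≤ t → ∀ M : ℝ,
            (∀ τ ∈ Set.Icc t (t + D), ∀ i, i < n + m → |jet s τ i| ≤ M) →
              stateNorm D ξ Y X P t ≤ γ M) ∧
          -- exponential convergence of the state norm when the target trajectory vanishes
          ((∀ t, 0 ≤ t → s t = 0) →
            ∃ C : ℝ, ∀ t, 0 ≤ t → stateNorm D ξ Y X P t ≤ C * Real.exp (-rate * t)) ∧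
          -- safety
          (∀ t, 0 ≤ t → s t ≤ coords (Y t) 0)) := by

  have hψc := fun i hi => (hψ i hi).1
  have hφc := fun j hj => (hφ j hj).1
  have hψ1 : ∀ i < n, ContDiff ℝ 1 (ψ i) := fun i hi =>
    (hψc i hi).of_le (by exact_mod_cast (by omega : 1 ≤ n + m - (i + 1)))
  choose L hL hLb using fun R => exists_state_bound (κ := cascadeGain n k c)
    (contDiff_cascade (b := b) hψc hφc)
    (cascade_zero (fun i hi => (hψ i hi).2) fun j hj => (hφ j hj).2) R (n + m) le_rfl
  -- `n` accounts for the entries of `P`, and `m |b⁻¹|` for those of `X` after undoing the scaling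
  -- by `b`.
  have hK : (0 : ℝ) ≤ n + m * |b⁻¹| := by positivity
  set K : ℝ := n + m * |b⁻¹| with hKdef
  -- The rate is that of the linear chain. In `γ` the radius is `max M 1` because eventually all
  -- errors are at most `1`, whatever the initial data.
  refine ⟨1, one_pos, fun M => (3 + Real.sqrt D) * (K * (L (max M 1) * max M 1)), ?_⟩
  intro s hs Y₀ X₀ ξ P₀ hξ hξ0 hP₀ hsP hΔ hk
  have hsc : ContinuousOn s (Set.Ici 0) := hs.continuousOn
  refine ⟨exists_isClosedLoopSolution hm hψc hφc hb hD hs hξ.continuousOn hξ0 hP₀, ?_⟩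
  intro Y X P h
  obtain ⟨hYP, hPd⟩ := h.predictor_ode hψ1 hD hξ.continuousOn hξ0 hP₀
  have hsP0 := hsP 0 ⟨by linarith, le_rfl⟩
  rw [zero_add] at hsP0
  obtain ⟨hreg, herr⟩ := h.error_nonneg_decay hm hψc hφc hb hD hs hPd hsP0 hΔ hk
  refine ⟨hreg, fun hc => ?_⟩
  obtain ⟨v, hvP, hvX, C, hC, he⟩ := herr hc
  have hx0 : ξ 0 = coords (X 0) 0 := by rw [hξ0, h.init_X]
  -- pointwise bounds of the plant and predictor states by the state of the cascade
  have hPX : ∀ t A, 0 ≤ A → (∀ i < n + m, |v i t| ≤ A) → ‖P t‖ ≤ K * A ∧ ‖X t‖ ≤ K * A := by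
    intro t A hA hv
    have h1 : ‖P t‖ ≤ n * A := norm_le_of_abs_coords_le hA fun i hi => by
      rw [← hvP t i hi]; exact hv i (by omega)
    have h2 : ‖X t‖ ≤ m * (|b⁻¹| * A) := norm_le_of_abs_coords_le (by positivity) fun j hj => by
      have h3 := hv (n + j) (by omega)
      rw [hvX t j hj] at h3
      calc |coords (X t) j| = |b⁻¹| * |b * coords (X t) j| := by
            rw [← abs_mul, inv_mul_cancel_left₀ hb]
        _ ≤ _ := by gcongr
    have h3 : (0 : ℝ) ≤ n * A := by positivity
    have h4 : (0 : ℝ) ≤ m * (|b⁻¹| * A) := by positivity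
    have h5 : K * A = n * A + m * (|b⁻¹| * A) := by rw [hKdef]; ring
    exact ⟨by linarith, by linarith⟩
  have hbound : ∀ R ε t, 0 ≤ t → ε ≤ R → C * Real.exp (-t) ≤ ε →
      (∀ i < n + m, |jet s (t + D) i| ≤ ε) →
      ‖P t‖ ≤ K * (L R * ε) ∧ ‖X t‖ ≤ K * (L R * ε) ∧ |inputSignal ξ X t| ≤ K * (L R * ε) := by
    intro R ε t ht hε hCε hσ
    have hε0 : 0 ≤ ε := le_trans (by positivity) hCε
    have h1 := hPX t (L R * ε) (mul_nonneg (hL R) hε0) (hLb R (fun l => v l t) _ ε hε hε0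
      (fun i hi => by
        rw [abs_of_nonneg (he i hi t ht).1]
        exact (he i hi t ht).2.trans hCε) hσ)
    refine ⟨h1.1, h1.2, ?_⟩
    rw [inputSignal_of_nonneg hx0 ht]
    exact (abs_coords_le_norm 0 _).trans h1.2
  obtain ⟨H, hH0, hH⟩ : ∃ H, 0 ≤ H ∧ ∀ θ ∈ Set.Icc (-D) 0,
      ‖P θ‖ ≤ H ∧ |inputSignal ξ X θ| ≤ H := by
    obtain ⟨H₁, hH₁⟩ := isCompact_Icc.exists_bound_of_continuousOn hP₀.continuousOn
    obtain ⟨H₂, hH₂⟩ := isCompact_Icc.exists_bound_of_continuousOn hξ.continuousOn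
    refine ⟨max (max H₁ H₂) 0, le_max_right _ _, fun θ hθ => ⟨?_, ?_⟩⟩
    · rw [h.init_P θ hθ]
      exact (hH₁ θ hθ).trans ((le_max_left _ _).trans (le_max_left _ _))
    · rw [inputSignal, if_pos hθ.2]
      exact (hH₂ θ hθ).trans ((le_max_right _ _).trans (le_max_left _ _))
  have hz0 : ∀ t, 0 ≤ t → backstepError 1 (cascade n b ψ φ) (cascadeGain n k c) 0
      (fun l => v l t) (jet s (t + D)) = coords (P t) 0 - s (t + D) := by
    intro t _
    simp [backstepError, virtualControl, jet, hvP t 0 hn]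
  refine ⟨?_, ?_, ?_, ?_, ?_⟩
  · obtain ⟨B, hB⟩ := isCompact_Icc.exists_bound_of_continuousOn
      (hsc.mono (fun t ht => ht.1 : Set.Icc 0 D ⊆ Set.Ici 0))
    have hB0 : 0 ≤ B := (norm_nonneg _).trans (hB 0 ⟨le_rfl, hD.le⟩)
    -- The factor `e^D` pays for the shift by `D`; `H + B` covers the first delay interval, where
    -- `Y` is read off the initial predictor.
    refine ⟨(C + (H + B)) * Real.exp D, fun t ht => ?_⟩
    have hexp : Real.exp D * Real.exp (-1 * t) = Real.exp (-(t - D)) := by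
      rw [← Real.exp_add]; ring_nf
    rw [mul_assoc, hexp, hYP t ht]
    rcases le_total D t with hDt | hDt
    · have h1 := he 0 (by omega) (t - D) (by linarith)
      rw [hz0 (t - D) (by linarith), sub_add_cancel] at h1
      rw [abs_of_nonneg h1.1]
      have : 0 ≤ (H + B) * Real.exp (-(t - D)) := by positivity
      linarith
    · have h1 := (abs_coords_le_norm 0 _).trans (hH (t - D) ⟨by linarith, by linarith⟩).1
      have h2 : |s t| ≤ B := hB t ⟨ht, hDt⟩
      have h3 := abs_sub (coords (P (t - D)) 0) (s t)
      have h4 : 1 ≤ Real.exp (-(t - D)) := Real.one_le_exp (by linarith)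
      nlinarith
  · rintro ⟨M, hM⟩
    have hbd := hbound (max C M) (max C M)
    have hA : 0 ≤ K * (L (max C M) * max C M) :=
      mul_nonneg hK (mul_nonneg (hL _) (hC.trans (le_max_left _ _)))
    generalize K * (L (max C M) * max C M) = A at hbd hA
    have hbd' : ∀ t, 0 ≤ t → ‖P t‖ ≤ A ∧ ‖X t‖ ≤ A ∧ |inputSignal ξ X t| ≤ A := fun t ht =>
      hbd t ht le_rfl ((mul_le_of_le_one_right hC (Real.exp_le_one_iff.2 (by linarith))).trans
        (le_max_left _ _)) fun i hi => (hM _ (by linarith) i hi).trans (le_max_right _ _)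
    refine ⟨(3 + Real.sqrt D) * (H + A), fun t ht => stateNorm_le hD.le (by positivity)
      (hYP t ht) (fun τ hτ => ?_) (fun τ hτ => ?_) (by linarith [(hbd' t ht).2.1])⟩
    · rcases le_total 0 τ with h0 | h0
      · linarith [(hbd' τ h0).1]
      · linarith [(hH τ ⟨by linarith [hτ.1], h0⟩).1]
    · rcases le_total 0 τ with h0 | h0
      · linarith [(hbd' τ h0).2.2]
      · linarith [(hH τ ⟨by linarith [hτ.1], h0⟩).2]
  -- On the window `[t - D, t]` one has `τ ≥ C`, so `e^τ ≥ C` and the errors are at most `C e^{-τ} ≤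
  -- 1`.
  · refine ⟨C + D, fun t htT ht M hM => ?_⟩
    have hbd : ∀ τ ∈ Set.Icc (t - D) t, _ := fun τ hτ =>
      hbound (max M 1) (max M 1) τ (by linarith [hτ.1]) le_rfl (by
        have h1 := Real.add_one_le_exp τ
        have h2 : C ≤ Real.exp τ := by linarith [hτ.1]
        refine le_trans ?_ (le_max_right _ _)
        rw [Real.exp_neg, ← div_eq_mul_inv]
        exact (div_le_one (Real.exp_pos τ)).2 h2)
        fun i hi => (hM (τ + D) ⟨by linarith [hτ.1], by linarith [hτ.2]⟩ i hi).trans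
          (le_max_left _ _)
    exact stateNorm_le hD.le (mul_nonneg hK (mul_nonneg (hL _)
      (zero_le_one.trans (le_max_right _ _)))) (hYP t ht) (fun τ hτ => (hbd τ hτ).1)
      (fun τ hτ => (hbd τ hτ).2.2) (hbd t ⟨by linarith, le_rfl⟩).2.1
  · intro hs0
    have hLC : 0 ≤ K * (L C * C) := mul_nonneg hK (mul_nonneg (hL C) hC)
    -- With zero reference the radius `C` is fixed while `ε = C e^{-τ}` shrinks, so the linear bound
    -- carries the decay over to the states.
    have hbd : ∀ τ : ℝ, 0 ≤ τ → _ := fun τ hτ => hbound C (C * Real.exp (-τ)) τ hτ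
      (mul_le_of_le_one_right hC (Real.exp_le_one_iff.2 (by linarith))) le_rfl
      fun i _ => by
        rw [jet_eq_zero hs0 (by linarith) i, abs_zero]
        positivity
    have hmul : ∀ τ, K * (L C * (C * Real.exp (-τ))) = K * (L C * C) * Real.exp (-τ) :=
      fun τ => by ring
    simp only [hmul] at hbd
    generalize K * (L C * C) = B at hbd hLC
    refine ⟨(3 + Real.sqrt D) * ((H + B) * Real.exp D), fun t ht => ?_⟩
    have hexp : ∀ τ, t - D ≤ τ → Real.exp (-τ) ≤ Real.exp D * Real.exp (-1 * t) := fun τ hτ => by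
      rw [← Real.exp_add]
      exact Real.exp_le_exp.2 (by linarith)
    -- Decaying values at positive times and history values bounded by `H` get one common bound,
    -- since `e^{-τ} ≥ 1` for `τ ≤ 0`.
    have hall : ∀ τ, t - D ≤ τ → ∀ r, (0 ≤ τ → r ≤ B * Real.exp (-τ)) → (τ ≤ 0 → r ≤ H) →
        r ≤ (H + B) * Real.exp D * Real.exp (-1 * t) := by
      intro τ hτ r h1 h2
      rw [mul_assoc]
      have h3 : (H + B) * Real.exp (-τ) ≤ (H + B) * (Real.exp D * Real.exp (-1 * t)) := by
        gcongr
        exact hexp τ hτ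
      refine le_trans ?_ h3
      have h4 := Real.exp_pos (-τ)
      rcases le_total 0 τ with h0 | h0
      · nlinarith [h1 h0]
      · have h5 : 1 ≤ Real.exp (-τ) := Real.one_le_exp (by linarith)
        nlinarith [h2 h0]
    rw [mul_assoc]
    exact stateNorm_le hD.le (by positivity) (hYP t ht)
      (fun τ hτ => hall τ hτ.1 _ (fun h0 => (hbd τ h0).1)
        fun h0 => (hH τ ⟨by linarith [hτ.1], h0⟩).1)
      (fun τ hτ => hall τ hτ.1 _ (fun h0 => (hbd τ h0).2.2)
        fun h0 => (hH τ ⟨by linarith [hτ.1], h0⟩).2)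
      ((hbd t ht).2.1.trans (by
        rw [mul_assoc]
        exact mul_le_mul (by linarith) (hexp t (by linarith)) (Real.exp_pos _).le (by linarith)))
  · intro t ht
    rw [hYP t ht]
    rcases le_total D t with hDt | hDt
    · have h1 := (he 0 (by omega) (t - D) (by linarith)).1
      rw [hz0 (t - D) (by linarith), sub_add_cancel] at h1
      linarith
    · have hθ : t - D ∈ Set.Icc (-D) 0 := ⟨by linarith, by linarith⟩
      have h1 := hsP _ hθ
      rw [sub_add_cancel] at h1
      rw [h.init_P _ hθ]
      exact h1.le
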